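/- Let $r\colon\mathbb R\to\mathbb R$ be a smooth function with $r>0$ on $(0,1)$, $r(0)=r(1)=0$ and $|r'(0)|,|r'(1)|<\frac1{2\pi}$. Let $\Sigma\subset\mathbb R^3$ be the surface of revolution parametrized by $$X\colon(0,1)\times\mathbb R\to\mathbb R^3,\qquad X(x,\phi)=(x,\;r(x)\cos\phi,\;r(x)\sin\phi),$$ with the metric $k=[1+r'(x)^2]\,dx^2+r(x)^2\,d\phi^2$ induced from $\mathbb R^3$, and let $(M,g)=(\mathbb R\times\Sigma,\,-dt^2+k)$, time-oriented by $\partial_t$. Let $\mathcal N_g$ be the space of null geodesics of $(M,g)$, i.e. the quotient, with the quotient topology, of the bundle of future pointing null vectors $$\{v\in TM \mid g(v,v)=0,\ v\neq 0,\ v\text{ future pointing}\}$$ by the equivalence relation that identifies two vectors if, up to multiplication by positive constants, they are velocity vectors of one and the same geodesic of $(M,g)$ (equivalently, the quotient by the geodesic flow and the flow of the Euler vector field). Then $\mathcal N_g$ is not Hausdorff. More precisely, there are a sequence $(\kappa_n)_{n\in\mathbb N}$ in $\mathcal N_g$ and two distinct elements $\kappa^1\neq\kappa^2$ of $\mathcal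 N_g$ such that $\kappa_n\to\kappa^1$ and $\kappa_n\to\kappa^2$, where each of $\kappa^1,\kappa^2$ is represented by a null geodesic whose projection to $\Sigma$ runs in a meridian $\{\phi=\mathrm{const}\}$. -/

import Mathlib

open Set Filter Topology
open scoped ContDiff

noncomputable section

namespace NullGeod

/-! ### Geodesic equation of a metric in coordinates -/

/-- The partial derivative `∂f/∂q^i` of a function of `n` real coordinates. -/
def pd {n : ℕ} {V : Type*} [NormedAddCommGroup V] [NormedSpace ℝ V]
    (i : Fin n) (f : (Fin n → ℝ) → V) (q : Fin n → ℝ) : V :=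
  fderiv ℝ f q (Pi.single i 1)

/-- The Christoffel symbol `Γ^k_{ij}` of the Levi-Civita connection of the metric with
coefficient matrix `G`. -/
def christoffel {n : ℕ} (G : (Fin n → ℝ) → Matrix (Fin n) (Fin n) ℝ) (k i j : Fin n)
    (q : Fin n → ℝ) : ℝ :=
  1 / 2 * ∑ l, (G q)⁻¹ k l *
    (pd i (fun y => G y j l) q + pd j (fun y => G y i l) q - pd l (fun y => G y i j) q)

/-- The geodesic equation `c''^k + Γ^k_{ij}(c) c'^i c'^j = 0` at the parameter `t`. -/
def GeodesicEqAt {n : ℕ} (G : (Fin n → ℝ) → Matrix (Fin n) (Fin n) ℝ)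
    (c : ℝ → Fin n → ℝ) (t : ℝ) : Prop :=
  ∀ k, deriv (deriv c) t k +
    ∑ i, ∑ j, christoffel G k i j (c t) * deriv c t i * deriv c t j = 0

/-! ### The surface of revolution and the static spacetime over it -/

/-- Euclidean three-space. -/
abbrev E3 : Type := EuclideanSpace ℝ (Fin 3)

/-- The parametrization `X(x, φ) = (x, r(x) cos φ, r(x) sin φ)`. -/
def param (r : ℝ → ℝ) (x φ : ℝ) : E3 :=
  !₂[x, r x * Real.cos φ, r x * Real.sin φ]

/-- The surface of revolution `Σ ⊆ ℝ³`. -/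
def surface (r : ℝ → ℝ) : Set E3 :=
  {p | ∃ x ∈ Ioo (0 : ℝ) 1, ∃ φ : ℝ, param r x φ = p}

/-- The meridian `φ = φ₀` of the surface. -/
def meridian (r : ℝ → ℝ) (φ₀ : ℝ) : Set E3 :=
  {p | ∃ x ∈ Ioo (0 : ℝ) 1, param r x φ₀ = p}

/-- The manifold `M = ℝ × Σ`, as a submanifold of `ℝ × ℝ³`. -/
def spacetime (r : ℝ → ℝ) : Set (ℝ × E3) := univ ×ˢ surface r

/-- The bilinear form `-dt² + ⟨·,·⟩` on `ℝ × ℝ³`. Its restriction to the tangent spaces of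
`M = ℝ × Σ` is the metric `g = -dt² + k`, where `k` is the metric induced on `Σ`. -/
def lorentz (v w : ℝ × E3) : ℝ := -(v.1 * w.1) + inner ℝ v.2 w.2

/-- The range `ℝ × (0,1) × ℝ` of the coordinates `(t, x, φ)`. -/
def coordDomain : Set (Fin 3 → ℝ) := {q | q 1 ∈ Ioo (0 : ℝ) 1}

/-- The parametrization `(t, x, φ) ↦ (t, X(x, φ))` of `M`. On `coordDomain` it is a local
diffeomorphism onto `M`; its local inverses are the coordinate charts of `M`. -/
def coords (r : ℝ → ℝ) (q : Fin 3 → ℝ) : ℝ × E3 := (q 0, param r (q 1) (q 2))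

/-- The tangent space of `M` at `p`, as a subset of `ℝ × ℝ³`. -/
def tangentSpace (r : ℝ → ℝ) (p : ℝ × E3) : Set (ℝ × E3) :=
  {v | ∃ q ∈ coordDomain, coords r q = p ∧ ∃ u, fderiv ℝ (coords r) q u = v}

/-- The coefficients `g(∂_i, ∂_j)` of `g` in the coordinates `(t, x, φ)`. -/
def metricCoeff (r : ℝ → ℝ) (q : Fin 3 → ℝ) : Matrix (Fin 3) (Fin 3) ℝ :=
  Matrix.of fun i j => lorentz (pd i (coords r) q) (pd j (coords r) q)

/-- `γ`, restricted to the open set `J`, is a geodesic of `(M, g)`: near every parameter it is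
`C²` in the coordinates `(t, x, φ)` and it solves the geodesic equation there. -/
def IsGeodesicOn (r : ℝ → ℝ) (γ : ℝ → ℝ × E3) (J : Set ℝ) : Prop :=
  ∀ t ∈ J, ∃ c : ℝ → Fin 3 → ℝ, ContDiffAt ℝ 2 c t ∧
    (∀ᶠ s in 𝓝 t, c s ∈ coordDomain ∧ γ s = coords r (c s)) ∧
    GeodesicEqAt (metricCoeff r) c t

/-! ### The space of null geodesics -/

/-- The bundle of future pointing null vectors `{v ∈ TM | g(v,v) = 0, v ≠ 0, v future pointing}`
(`∂_t` defines the time orientation), with the topology of `TM ⊆ (ℝ × ℝ³) × (ℝ × ℝ³)`.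
A point is a pair (base point, vector). -/
def FutureNullCone (r : ℝ → ℝ) : Type :=
  {v : (ℝ × E3) × (ℝ × E3) // v.1 ∈ spacetime r ∧ v.2 ∈ tangentSpace r v.1 ∧
    lorentz v.2 v.2 = 0 ∧ v.2 ≠ 0 ∧ lorentz (1, 0) v.2 < 0}

instance (r : ℝ → ℝ) : TopologicalSpace (FutureNullCone r) :=
  inferInstanceAs (TopologicalSpace (Subtype _))

/-- `v` is the velocity vector of the curve `γ` at the parameter `s`. -/
def IsVelocity {r : ℝ → ℝ} (γ : ℝ → ℝ × E3) (s : ℝ) (v : FutureNullCone r) : Prop :=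
  γ s = v.1.1 ∧ deriv γ s = v.1.2

/-- The null vectors `v` and `w` are tangent to one and the same geodesic, up to positive
scaling: they are related by the geodesic flow and the flow of the Euler vector field. -/
def SameLeaf (r : ℝ → ℝ) (v w : FutureNullCone r) : Prop :=
  ∃ (γ : ℝ → ℝ × E3) (J : Set ℝ), IsOpen J ∧ J.OrdConnected ∧ IsGeodesicOn r γ J ∧
    ∃ s ∈ J, ∃ t ∈ J, ∃ a : ℝ, 0 < a ∧
      IsVelocity γ s v ∧ γ t = w.1.1 ∧ deriv γ t = a • w.1.2

/-- The space of null geodesics `𝒩_g`: the quotient of the future null cone bundle by the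
equivalence relation of lying on the same leaf. -/
def NullGeodesicSpace (r : ℝ → ℝ) : Type := Quot (SameLeaf r)

/-- `𝒩_g` carries the quotient topology. -/
instance (r : ℝ → ℝ) : TopologicalSpace (NullGeodesicSpace r) :=
  inferInstanceAs (TopologicalSpace (Quot _))

/-- The null geodesic tangent to a future pointing null vector. -/
def toNullGeodesic {r : ℝ → ℝ} (v : FutureNullCone r) : NullGeodesicSpace r := Quot.mk _ v

/-- The null geodesic `κ` comes from a meridian: it is represented by a geodesic of `(M, g)`
whose projection to `Σ` runs in a meridian. -/
def IsOverMeridian {r : ℝ → ℝ} (κ : NullGeodesicSpace r) : Prop :=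
  ∃ (γ : ℝ → ℝ × E3) (J : Set ℝ) (φ₀ : ℝ), IsOpen J ∧ J.OrdConnected ∧ IsGeodesicOn r γ J ∧
    (∀ s ∈ J, (γ s).2 ∈ meridian r φ₀) ∧
    ∃ s ∈ J, ∃ v : FutureNullCone r, IsVelocity γ s v ∧ toNullGeodesic v = κ

/-! ### The metric in coordinates -/

theorem fderiv_coords_apply {r : ℝ → ℝ} (hr : Differentiable ℝ r) (q u : Fin 3 → ℝ) :
    fderiv ℝ (coords r) q u =
      (u 0, !₂[u 1, deriv r (q 1) * u 1 * Real.cos (q 2) - r (q 1) * Real.sin (q 2) * u 2,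
        deriv r (q 1) * u 1 * Real.sin (q 2) + r (q 1) * Real.cos (q 2) * u 2]) := by
  have p (i : Fin 3) : HasFDerivAt (fun y : Fin 3 → ℝ => y i)
      (ContinuousLinearMap.proj (R := ℝ) (φ := fun _ : Fin 3 => ℝ) i) q := hasFDerivAt_apply i q
  have h1 := (hr (q 1)).hasDerivAt.comp_hasFDerivAt q (p 1)
  have hc := (Real.hasDerivAt_cos (q 2)).comp_hasFDerivAt q (p 2)
  have hs := (Real.hasDerivAt_sin (q 2)).comp_hasFDerivAt q (p 2)
  have hd : DifferentiableAt ℝ (fun y : Fin 3 → ℝ => param r (y 1) (y 2)) q := by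
    rw [differentiableAt_euclidean]
    intro i
    fin_cases i
    · exact (p 1).differentiableAt
    · exact (h1.mul hc).differentiableAt
    · exact (h1.mul hs).differentiableAt
  have key := hd.hasFDerivAt
  have key' := key
  rw [← hasFDerivWithinAt_univ, hasFDerivWithinAt_euclidean] at key'
  simp only [hasFDerivWithinAt_univ] at key'
  have hF : HasFDerivAt (coords r) _ q := (p 0).prodMk key
  rw [hF.fderiv]
  refine Prod.ext rfl ?_
  ext i
  fin_cases i
  · exact congrArg (fun L => L u) ((key' 0).unique (p 1))
  · refine (congrArg (fun L => L u) ((key' 1).unique (h1.mul hc))).trans ?_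
    simp
    ring
  · refine (congrArg (fun L => L u) ((key' 2).unique (h1.mul hs))).trans ?_
    simp
    ring

/-- In the coordinates `(t, x, φ)` one has `g = -dt² + (1 + r'(x)²) dx² + r(x)² dφ²`. -/
theorem metricCoeff_eq {r : ℝ → ℝ} (hr : Differentiable ℝ r) (q : Fin 3 → ℝ) :
    metricCoeff r q = Matrix.diagonal ![-1, 1 + deriv r (q 1) ^ 2, r (q 1) ^ 2] := by
  have hcs := Real.sin_sq_add_cos_sq (q 2)
  ext i j
  simp only [metricCoeff, pd, fderiv_coords_apply hr, lorentz, Matrix.of_apply,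
    PiLp.inner_apply, Fin.sum_univ_three, RCLike.inner_apply, conj_trivial]
  fin_cases i <;> fin_cases j <;>
    simp [-abs_mul_abs_self] <;> ring_nf <;>
    first
      | done
      | linear_combination (deriv r (q 1)) ^ 2 * hcs
      | linear_combination (r (q 1)) ^ 2 * hcs

end NullGeod

end

noncomputable section

namespace NullGeod

/-! A geodesic of Σ with small angular momentum runs up to the end `x = 1` almost along a meridian,
turns, and comes back almost along a meridian. If it needs only bounded time for this, its outgoing
and its incoming velocity at `x = 1/2` converge separately, although both represent one null
geodesic.

The bound on the time comes from the choice of the turning point. Clairaut's relation for a unit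
speed geodesic tangent to the parallel at `b` reads `r(x) cos θ = r(b)`. Take `b` such that `r(y)
e^y` is minimal over `[1/2, b]` at `b` (`exists_turning_point`). Then `cos θ ≤ e^{-(b-x)}`, hence
`sin θ ≥ √(b-x)`, and `√(b-x)` grows at rate at least `1/(2K)`, where `K` bounds `√(1+r'²)`. So `x =
1/2` is reached before time `2K + 1`, whatever `b` is (`exists_reach`), and by time reversal also in
the past.

Modulo `2π` in the angles, both crossings of `x = 1/2` lie in a fixed compact set (`exists_bounce`).
As `r(b) → 0`, subsequences converge to null vectors over meridians, one outgoing and one incoming.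
Having zero angular momentum and moving outwards is invariant along a geodesic
(`SameLeaf.isOutgoing_iff`), so the two limits are distinct points of the quotient. -/

/-! ### Cutoff of the profile and integral curves of bounded fields. -/

/-- A positive function agreeing with `r` on the middle part of `(0, 1)` and equal to `1` outside a
compact set. -/
theorem exists_cutoff {r : ℝ → ℝ} (hr : ContDiff ℝ ∞ r) (hpos : ∀ x ∈ Ioo (0 : ℝ) 1, 0 < r x)
    {δ : ℝ} (hδ : 0 < δ) (hδ' : δ < 1 / 2) :
    ∃ ρ : ℝ → ℝ, ContDiff ℝ ∞ ρ ∧ (∀ x, 0 < ρ x) ∧ HasCompactSupport (fun x => ρ x - 1) ∧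
      ∀ x ∈ Ioo δ (1 - δ), ρ x = r x := by
  -- The inner ball covers `(δ, 1 - δ)`; the outer ball is `(δ/2, 1 - δ/2)`, where `r > 0`, so the
  -- convex combination `χ r + (1 - χ)` is positive.
  let χ : ContDiffBump (1 / 2 : ℝ) := ⟨1 / 2 - δ, 1 / 2 - δ / 2, by linarith, by linarith⟩
  refine ⟨fun x => χ x * (r x - 1) + 1, ?_, ?_, ?_, ?_⟩
  · exact (χ.contDiff.mul (hr.sub contDiff_const)).add contDiff_const
  · intro x
    by_cases hx : x ∈ Metric.ball (1 / 2 : ℝ) χ.rOut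
    · have h1 : χ x ≤ 1 := χ.le_one
      have h0 : 0 < χ x := χ.pos_of_mem_ball hx
      have : 0 < r x := by
        apply hpos
        rw [Real.ball_eq_Ioo] at hx
        simp only [χ] at hx
        constructor <;> linarith [hx.1, hx.2]
      nlinarith [mul_pos h0 this]
    · have : χ x = 0 := by
        apply χ.zero_of_le_dist
        simpa using hx
      simp [this]
  · simp only [add_sub_cancel_right]
    exact χ.hasCompactSupport.mul_right
  · intro x hx
    have : χ x = 1 := by
      apply χ.one_of_mem_closedBall
      rw [Real.closedBall_eq_Icc]
      simp only [χ]
      constructor <;> linarith [hx.1, hx.2]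
    simp [this]

/-- A continuous function that is constant outside a compact set is bounded. -/
theorem exists_abs_le_of_hasCompactSupport_sub {f : ℝ → ℝ} (hf : Continuous f) (c : ℝ)
    (h : HasCompactSupport (fun x => f x - c)) : ∃ C, ∀ x, |f x| ≤ C := by
  obtain ⟨C, hC⟩ := h.exists_bound_of_continuous (hf.sub continuous_const)
  refine ⟨C + |c|, fun x => ?_⟩
  have := hC x
  rw [Real.norm_eq_abs] at this
  calc |f x| = |(f x - c) + c| := by ring_nf
    _ ≤ |f x - c| + |c| := abs_add_le _ _
    _ ≤ _ := by linarith

/-- A bounded `C¹` vector field has integral curves on every compact time interval. -/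
theorem exists_integralCurve_of_bounded {E : Type*} [NormedAddCommGroup E] [NormedSpace ℝ E]
    [FiniteDimensional ℝ E] {F : E → E} (hF : ContDiff ℝ 1 F) {C : ℝ}
    (hC : ∀ z, ‖F z‖ ≤ C) (z₀ : E) {T : ℝ} (hT : 0 < T) :
    ∃ z : ℝ → E, z 0 = z₀ ∧ ∀ s ∈ Ioo (-T) T, HasDerivAt z (F (z s)) s := by
  have hC0 : 0 ≤ C := (norm_nonneg _).trans (hC z₀)
  have : ProperSpace E := FiniteDimensional.proper ℝ E
  obtain ⟨K, hK⟩ := (hF.locallyLipschitz.locallyLipschitzOn).exists_lipschitzOnWith_of_compact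
    (isCompact_closedBall z₀ (C * T))
  -- With speed at most `C`, a curve cannot leave the ball of radius `C * T` within time `T`, so
  -- Picard–Lindelöf covers the whole interval.
  have hPL : IsPicardLindelof (fun _ => F) (tmin := -T) (tmax := T)
      ⟨0, by constructor <;> linarith⟩ z₀ ⟨C * T, by positivity⟩ 0 ⟨C, hC0⟩ K := by
    refine ⟨fun _ _ => hK, fun _ _ => continuousOn_const, fun _ _ z _ => hC z, ?_⟩
    simp only [zero_sub, sub_zero, neg_neg, max_self, NNReal.coe_zero]
    exact le_rfl
  obtain ⟨z, hz0, hz⟩ := hPL.exists_eq_forall_mem_Icc_hasDerivWithinAt₀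
  exact ⟨z, hz0, fun s hs => (hz s ⟨hs.1.le, hs.2.le⟩).hasDerivAt (Icc_mem_nhds hs.1 hs.2)⟩

/-- The integral curves of a `C¹` vector field are `C²`. -/
theorem contDiffAt_two_of_integralCurve {E : Type*} [NormedAddCommGroup E] [NormedSpace ℝ E]
    {F : E → E} (hF : ContDiff ℝ 1 F) {z : ℝ → E} {U : Set ℝ} (hU : IsOpen U)
    (hz : ∀ s ∈ U, HasDerivAt z (F (z s)) s) {s : ℝ} (hs : s ∈ U) : ContDiffAt ℝ 2 z s := by
  have hd : DifferentiableOn ℝ z U := fun t ht =>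
    (hz t ht).differentiableAt.differentiableWithinAt
  have key : ∀ n : ℕ, n ≤ 1 → ContDiffOn ℝ n z U → ContDiffOn ℝ (n + 1) z U := by
    intro n hn h
    rw [contDiffOn_succ_iff_deriv_of_isOpen hU]
    refine ⟨hd, by simp, ?_⟩
    refine ContDiffOn.congr ?_ (fun t ht => (hz t ht).deriv)
    exact (hF.of_le (by exact_mod_cast hn)).comp_contDiffOn h
  have h1 : ContDiffOn ℝ 1 z U := by
    simpa using key 0 (by norm_num) (by simpa using hd.continuousOn)
  have h2 := key 1 le_rfl (by simpa using h1)
  norm_num at h2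
  exact h2.contDiffAt (hU.mem_nhds hs)

/-! ### The unit speed geodesic flow in the angular coordinate -/

/-- The inverse of the length of the coordinate vector `∂_x`. -/
def invSpeed (ρ : ℝ → ℝ) (x : ℝ) : ℝ := (√(1 + deriv ρ x ^ 2))⁻¹

/-- The unit speed geodesic field on the surface of revolution with profile `ρ`, in the coordinates
`(x, θ, φ)`, where `θ` is the angle between the velocity and the parallel. -/
def unitField (ρ : ℝ → ℝ) (z : ℝ × ℝ × ℝ) : ℝ × ℝ × ℝ :=
  (-Real.sin z.2.1 * invSpeed ρ z.1,
    -(deriv ρ z.1 / ρ z.1) * invSpeed ρ z.1 * Real.cos z.2.1, Real.cos z.2.1 / ρ z.1)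

theorem invSpeed_pos (ρ : ℝ → ℝ) (x : ℝ) : 0 < invSpeed ρ x := by
  unfold invSpeed; positivity

theorem invSpeed_le_one (ρ : ℝ → ℝ) (x : ℝ) : invSpeed ρ x ≤ 1 := by
  unfold invSpeed
  apply inv_le_one_of_one_le₀
  rw [Real.one_le_sqrt]
  nlinarith [sq_nonneg (deriv ρ x)]

theorem invSpeed_sq (ρ : ℝ → ℝ) (x : ℝ) : invSpeed ρ x ^ 2 * (1 + deriv ρ x ^ 2) = 1 := by
  have h : 0 < 1 + deriv ρ x ^ 2 := by positivity
  unfold invSpeed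
  rw [inv_pow, Real.sq_sqrt h.le, inv_mul_cancel₀ h.ne']

theorem contDiff_deriv {ρ : ℝ → ℝ} (hρ : ContDiff ℝ ∞ ρ) : ContDiff ℝ ∞ (deriv ρ) :=
  (contDiff_infty_iff_deriv.1 hρ).2

theorem contDiff_invSpeed {ρ : ℝ → ℝ} (hρ : ContDiff ℝ ∞ ρ) : ContDiff ℝ ∞ (invSpeed ρ) := by
  have h : ∀ x, 1 + deriv ρ x ^ 2 ≠ 0 := fun x => by positivity
  exact ((contDiff_const.add ((contDiff_deriv hρ).pow 2)).sqrt h).inv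
    fun x => by have := h x; positivity

theorem hasDerivAt_invSpeed {ρ : ℝ → ℝ} (hρ : ContDiff ℝ ∞ ρ) (x : ℝ) :
    HasDerivAt (invSpeed ρ) (-(deriv ρ x * deriv (deriv ρ) x * invSpeed ρ x ^ 3)) x := by
  have h : 0 < 1 + deriv ρ x ^ 2 := by positivity
  have hd : HasDerivAt (deriv ρ) (deriv (deriv ρ) x) x :=
    ((contDiff_deriv hρ).differentiable (by simp) x).hasDerivAt
  have h1 := (((hd.pow 2).const_add 1).sqrt h.ne').inv (by positivity)
  refine h1.congr_deriv ?_
  unfold invSpeed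
  have hs : √(1 + deriv ρ x ^ 2) ≠ 0 := by positivity
  simp only [Pi.pow_apply, Nat.cast_ofNat, Nat.add_one_sub_one, pow_one]
  generalize √(1 + deriv ρ x ^ 2) = w at hs
  field_simp

theorem contDiff_unitField {ρ : ℝ → ℝ} (hρ : ContDiff ℝ ∞ ρ) (hpos : ∀ x, 0 < ρ x) :
    ContDiff ℝ ∞ (unitField ρ) := by
  have hx : ContDiff ℝ ∞ (fun z : ℝ × ℝ × ℝ => z.1) := contDiff_fst
  have hθ : ContDiff ℝ ∞ (fun z : ℝ × ℝ × ℝ => z.2.1) := contDiff_fst.comp contDiff_snd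
  have hA := (contDiff_invSpeed hρ).comp hx
  have hρ' := (contDiff_deriv hρ).comp hx
  have hρx := hρ.comp hx
  have hne : ∀ z : ℝ × ℝ × ℝ, (ρ ∘ fun z => z.1) z ≠ 0 := fun z => (hpos z.1).ne'
  exact ((Real.contDiff_sin.comp hθ).neg.mul hA).prodMk
    ((((hρ'.div hρx hne).neg.mul hA).mul (Real.contDiff_cos.comp hθ)).prodMk
      ((Real.contDiff_cos.comp hθ).div hρx hne))

/-- Since `ρ = 1` off a compact set, `1/ρ` and `ρ'` are bounded. This is the purpose of the cutoff:
solutions live on any prescribed time interval. -/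
theorem exists_bound_unitField {ρ : ℝ → ℝ} (hρ : ContDiff ℝ ∞ ρ) (hpos : ∀ x, 0 < ρ x)
    (hcs : HasCompactSupport (fun x => ρ x - 1)) : ∃ C, ∀ z, ‖unitField ρ z‖ ≤ C := by
  have hinv : Continuous fun x => (ρ x)⁻¹ := hρ.continuous.inv₀ fun x => (hpos x).ne'
  obtain ⟨C₁, h₁⟩ := exists_abs_le_of_hasCompactSupport_sub hinv 1 <| by
    have : (fun x => (ρ x)⁻¹ - 1) = fun x => (ρ x - 1) * -(ρ x)⁻¹ := by
      ext x
      have := (hpos x).ne'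
      field_simp
      ring
    rw [this]
    exact hcs.mul_right
  obtain ⟨C₂, h₂⟩ := exists_abs_le_of_hasCompactSupport_sub
    (contDiff_deriv hρ).continuous 0 <| by
    have : (fun x => deriv ρ x - 0) = deriv fun x => ρ x - 1 := by
      ext x
      simp
    rw [this]
    exact hcs.deriv
  refine ⟨max 1 (max (C₂ * C₁) C₁), fun z => ?_⟩
  have hs := Real.abs_sin_le_one z.2.1
  have hc := Real.abs_cos_le_one z.2.1
  have hA : |invSpeed ρ z.1| ≤ 1 := by
    rw [abs_of_pos (invSpeed_pos ρ _)]; exact invSpeed_le_one ρ _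
  have hC₁ : 0 ≤ C₁ := (abs_nonneg _).trans (h₁ 0)
  have hC₂ : 0 ≤ C₂ := (abs_nonneg _).trans (h₂ 0)
  rw [Prod.norm_def, Prod.norm_def]
  refine max_le_max ?_ (max_le_max ?_ ?_)
  · simp only [unitField, Real.norm_eq_abs, abs_mul, abs_neg]
    exact mul_le_one₀ hs (abs_nonneg _) hA
  · simp only [unitField, Real.norm_eq_abs, abs_mul, abs_neg, div_eq_mul_inv]
    calc _ ≤ (C₂ * C₁) * 1 * 1 := by
          gcongr
          · exact h₂ _
          · exact h₁ _
      _ = _ := by ring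
  · simp only [unitField, Real.norm_eq_abs, abs_mul, div_eq_mul_inv]
    calc _ ≤ 1 * C₁ := by
          gcongr
          exact h₁ _
      _ = _ := by ring

/-- `z` solves the unit speed geodesic equation of the profile `ρ` on `(-T, T)`. -/
def IsUnitSolution (ρ : ℝ → ℝ) (z : ℝ → ℝ × ℝ × ℝ) (T : ℝ) : Prop :=
  ∀ s ∈ Ioo (-T) T, HasDerivAt z (unitField ρ (z s)) s

theorem exists_isUnitSolution {ρ : ℝ → ℝ} (hρ : ContDiff ℝ ∞ ρ) (hpos : ∀ x, 0 < ρ x)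
    (hcs : HasCompactSupport (fun x => ρ x - 1)) (z₀ : ℝ × ℝ × ℝ) {T : ℝ} (hT : 0 < T) :
    ∃ z, z 0 = z₀ ∧ IsUnitSolution ρ z T := by
  obtain ⟨C, hC⟩ := exists_bound_unitField hρ hpos hcs
  exact exists_integralCurve_of_bounded ((contDiff_unitField hρ hpos).of_le (by simp)) hC z₀ hT

namespace IsUnitSolution

variable {ρ : ℝ → ℝ} {z : ℝ → ℝ × ℝ × ℝ} {T : ℝ}

theorem hasDerivAt_x (h : IsUnitSolution ρ z T) {s : ℝ} (hs : s ∈ Ioo (-T) T) :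
    HasDerivAt (fun s => (z s).1) (-Real.sin (z s).2.1 * invSpeed ρ (z s).1) s :=
  (h s hs).fst

theorem hasDerivAt_angle (h : IsUnitSolution ρ z T) {s : ℝ} (hs : s ∈ Ioo (-T) T) :
    HasDerivAt (fun s => (z s).2.1)
      (-(deriv ρ (z s).1 / ρ (z s).1) * invSpeed ρ (z s).1 * Real.cos (z s).2.1) s :=
  (h s hs).snd.fst

theorem hasDerivAt_longitude (h : IsUnitSolution ρ z T) {s : ℝ} (hs : s ∈ Ioo (-T) T) :
    HasDerivAt (fun s => (z s).2.2) (Real.cos (z s).2.1 / ρ (z s).1) s :=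
  (h s hs).snd.snd

/-- Clairaut's relation. -/
theorem clairaut (h : IsUnitSolution ρ z T) (hρ : ContDiff ℝ ∞ ρ) (hpos : ∀ x, 0 < ρ x) {s : ℝ}
    (hs : s ∈ Ioo (-T) T) :
    ρ (z s).1 * Real.cos (z s).2.1 = ρ (z 0).1 * Real.cos (z 0).2.1 := by
  have hT : (0 : ℝ) ∈ Ioo (-T) T := by constructor <;> linarith [hs.1, hs.2]
  have hd : ∀ t ∈ Ioo (-T) T,
      HasDerivAt (fun s => ρ (z s).1 * Real.cos (z s).2.1) 0 t := by
    intro t ht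
    have h1 : HasDerivAt ρ (deriv ρ (z t).1) (z t).1 :=
      (hρ.differentiable (by simp) _).hasDerivAt
    refine ((h1.comp t (h.hasDerivAt_x ht)).mul (h.hasDerivAt_angle ht).cos).congr_deriv ?_
    have := (hpos (z t).1).ne'
    simp only [Function.comp]
    field_simp
    ring
  exact isOpen_Ioo.is_const_of_deriv_eq_zero isPreconnected_Ioo
    (fun t ht => (hd t ht).differentiableAt.differentiableWithinAt)
    (fun t ht => (hd t ht).deriv) hs hT

/-- Time reversal. -/
theorem reverse (h : IsUnitSolution ρ z T) :
    IsUnitSolution ρ (fun s => ((z (-s)).1, -(z (-s)).2.1, -(z (-s)).2.2)) T := by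
  intro s hs
  have hs' : -s ∈ Ioo (-T) T := ⟨by linarith [hs.2], by linarith [hs.1]⟩
  have hx := (h.hasDerivAt_x hs').scomp s (hasDerivAt_neg s)
  have hθ := ((h.hasDerivAt_angle hs').scomp s (hasDerivAt_neg s)).neg
  have hφ := ((h.hasDerivAt_longitude hs').scomp s (hasDerivAt_neg s)).neg
  refine (hx.prodMk (hθ.prodMk hφ)).congr_deriv ?_
  simp [unitField]

end IsUnitSolution

/-! ### Time needed to leave a turning point. -/

/-- The first time at which a continuous function hits a value from above. -/
theorem exists_first_hit {f : ℝ → ℝ} {p q a : ℝ} (hpq : p ≤ q) (hf : ContinuousOn f (Icc p q))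
    (hp : a < f p) (hq : f q ≤ a) : ∃ s ∈ Ioc p q, f s = a ∧ ∀ t ∈ Ico p s, a < f t := by
  have hc : IsCompact (Icc p q ∩ f ⁻¹' {a}) :=
    isCompact_Icc.of_isClosed_subset (hf.preimage_isClosed_of_isClosed isClosed_Icc
      isClosed_singleton) inter_subset_left
  obtain ⟨u, hu, hua⟩ := intermediate_value_Icc' hpq hf ⟨hq, hp.le⟩
  obtain ⟨s, ⟨hs, hsa⟩, hmin⟩ := hc.exists_isLeast ⟨u, hu, hua⟩
  refine ⟨s, ⟨lt_of_le_of_ne hs.1 ?_, hs.2⟩, hsa, fun t ht => ?_⟩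
  · rintro rfl
    exact hp.ne' hsa
  · by_contra! h
    obtain ⟨v, hv, hva⟩ := intermediate_value_Icc' ht.1
      (hf.mono (Icc_subset_Icc_right (ht.2.le.trans hs.2))) ⟨h, hp.le⟩
    have := hmin ⟨⟨hv.1, hv.2.trans (ht.2.le.trans hs.2)⟩, hva⟩
    linarith [hv.2, ht.2]

/-- If `ρ(y) e^y` is minimal over `[a, b]` at `b`, then `ρ' ≤ -ρ` at `b`. -/
theorem deriv_le_neg_of_growth {ρ : ℝ → ℝ} (hρ : Differentiable ℝ ρ) {a b : ℝ} (hab : a < b)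
    (hgrow : ∀ y ∈ Icc a b, ρ b * Real.exp (b - y) ≤ ρ y) : deriv ρ b ≤ -ρ b := by
  have hd : HasDerivAt (fun y => ρ y - ρ b * Real.exp (b - y)) (deriv ρ b + ρ b) b := by
    have h1 : HasDerivAt (fun y => b - y) (-1) b := by
      simpa using (hasDerivAt_id b).const_sub b
    refine ((hρ b).hasDerivAt.sub (h1.exp.const_mul (ρ b))).congr_deriv ?_
    simp
  have ht := (hasDerivAt_iff_tendsto_slope.1 hd).mono_left
    (nhdsWithin_mono b (fun y (hy : y < b) => hy.ne) : 𝓝[<] b ≤ 𝓝[≠] b)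
  have : deriv ρ b + ρ b ≤ 0 := by
    refine le_of_tendsto ht ?_
    filter_upwards [Ioo_mem_nhdsLT hab] with y hy
    rw [slope_def_field]
    have := hgrow y ⟨hy.1.le, hy.2.le⟩
    apply div_nonpos_of_nonneg_of_nonpos
    · simp
      linarith
    · linarith [hy.2]
  linarith

/-- `1 - e^{-2y} ≥ y` on `[0, 1/2]`. -/
theorem le_one_sub_exp_sq {y : ℝ} (h0 : 0 ≤ y) (h1 : y ≤ 1 / 2) :
    y ≤ 1 - (Real.exp (-y)) ^ 2 := by
  have h : Real.exp (-y) ≤ 1 / (1 + y) := by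
    rw [Real.exp_neg, inv_eq_one_div]
    exact one_div_le_one_div_of_le (by linarith) (by linarith [Real.add_one_le_exp y])
  have h2 : (Real.exp (-y)) ^ 2 ≤ (1 / (1 + y)) ^ 2 :=
    pow_le_pow_left₀ (Real.exp_pos _).le h 2
  -- Amounts to `y (1 - y - y²) ≥ 0`, which holds for `y ≤ 1/2`.
  have h3 : (1 / (1 + y)) ^ 2 ≤ 1 - y := by
    rw [div_pow, div_le_iff₀ (by positivity)]
    nlinarith [mul_nonneg h0 h0, mul_nonneg h0 (mul_nonneg h0 h0)]
  linarith

namespace IsUnitSolution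

variable {ρ : ℝ → ℝ} {z : ℝ → ℝ × ℝ × ℝ} {T a b K : ℝ}

/-- The angle starts to grow because `ρ'(b) < 0`. It cannot reach `π/2`, as Clairaut keeps `cos θ`
positive. It cannot return to `0` either: there `ρ(x) = ρ(b)` with `x < b`, against the growth
condition. -/
theorem angle_pos (h : IsUnitSolution ρ z T) (hρ : ContDiff ℝ ∞ ρ) (hpos : ∀ x, 0 < ρ x)
    (hab : a < b) (hx0 : (z 0).1 = b) (hθ0 : (z 0).2.1 = 0)
    (hgrow : ∀ y ∈ Icc a b, ρ b * Real.exp (b - y) ≤ ρ y)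
    {τ : ℝ} (hτT : τ < T) (hax : ∀ t ∈ Icc 0 τ, a ≤ (z t).1) :
    ∀ t ∈ Ioc 0 τ, (z t).2.1 ∈ Ioo 0 (Real.pi / 2) := by
  intro t ht
  have hmem : ∀ u ∈ Icc 0 t, u ∈ Ioo (-T) T := fun u hu =>
    ⟨by linarith [hu.1, hu.2, ht.1, ht.2], by linarith [hu.2, ht.2]⟩
  have hcos : ∀ u ∈ Icc 0 t, 0 < Real.cos (z u).2.1 := by
    intro u hu
    have := h.clairaut hρ hpos (hmem u hu)
    rw [hθ0, Real.cos_zero, mul_one] at this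
    exact pos_of_mul_pos_right (this ▸ hpos _) (hpos _).le
  have hcθ : ContinuousOn (fun s => (z s).2.1) (Icc 0 t) := fun u hu =>
    (h.hasDerivAt_angle (hmem u hu)).continuousAt.continuousWithinAt
  have hcx : ContinuousOn (fun s => (z s).1) (Icc 0 t) := fun u hu =>
    (h.hasDerivAt_x (hmem u hu)).continuousAt.continuousWithinAt
  have hlt : ∀ u ∈ Icc 0 t, (z u).2.1 < Real.pi / 2 := by
    intro u hu
    by_contra! hle
    obtain ⟨v, hv, hva⟩ := intermediate_value_Icc hu.1
      (hcθ.mono (Icc_subset_Icc_right hu.2))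
      (show Real.pi / 2 ∈ Icc ((z 0).2.1) ((z u).2.1) from
        ⟨by rw [hθ0]; positivity, hle⟩)
    have := hcos v ⟨hv.1, hv.2.trans hu.2⟩
    simp only [] at hva
    rw [hva, Real.cos_pi_div_two] at this
    exact lt_irrefl _ this
  refine ⟨?_, hlt t ⟨ht.1.le, le_rfl⟩⟩
  by_contra! hneg
  -- the angle increases at the turning point
  have hd := h.hasDerivAt_angle (hmem 0 ⟨le_rfl, ht.1.le⟩)
  rw [hx0, hθ0, Real.cos_zero, mul_one] at hd
  have hdpos : 0 < -(deriv ρ b / ρ b) * invSpeed ρ b := by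
    refine mul_pos ?_ (invSpeed_pos _ _)
    have := deriv_le_neg_of_growth (hρ.differentiable (by simp)) hab hgrow
    rw [neg_pos]
    exact div_neg_of_neg_of_pos (by linarith [hpos b]) (hpos b)
  have hev : ∀ᶠ u in 𝓝[>] (0 : ℝ), 0 < (z u).2.1 := by
    have ht := (hasDerivAt_iff_tendsto_slope.1 hd).mono_left
      (nhdsWithin_mono 0 (fun y (hy : 0 < y) => hy.ne') : 𝓝[>] (0 : ℝ) ≤ 𝓝[≠] 0)
    filter_upwards [ht.eventually_const_lt hdpos, self_mem_nhdsWithin] with u hu hu0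
    rw [slope_def_field, hθ0, sub_zero, sub_zero] at hu
    exact (div_pos_iff_of_pos_right hu0).1 hu
  obtain ⟨ε, hε, hεpos⟩ := mem_nhdsGT_iff_exists_Ioc_subset.1 hev
  have hε0 : 0 < ε := hε
  have hεt : ε ≤ t := by
    by_contra! hlt
    have : 0 < (z t).2.1 := hεpos ⟨ht.1, hlt.le⟩
    linarith
  -- `s` is the first return of the angle to `0`; up to then `x` strictly decreases.
  obtain ⟨s, hs, hs0, hspos⟩ := exists_first_hit hεt
    (hcθ.mono (Icc_subset_Icc_left hε0.le)) (hεpos ⟨hε0, le_rfl⟩) hneg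
  have hs0t : 0 < s := hε0.trans hs.1
  have hposs : ∀ u ∈ Ioo 0 s, 0 < (z u).2.1 := by
    intro u hu
    rcases le_or_gt u ε with h1 | h1
    · exact hεpos ⟨hu.1, h1⟩
    · exact hspos u ⟨h1.le, hu.2⟩
  have hanti : StrictAntiOn (fun s => (z s).1) (Icc 0 s) := by
    refine strictAntiOn_of_deriv_neg (convex_Icc 0 s) (hcx.mono (Icc_subset_Icc_right hs.2)) ?_
    intro u hu
    rw [interior_Icc] at hu
    have hu' : u ∈ Icc 0 t := ⟨hu.1.le, hu.2.le.trans hs.2⟩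
    rw [(h.hasDerivAt_x (hmem u hu')).deriv]
    have : 0 < Real.sin (z u).2.1 :=
      Real.sin_pos_of_pos_of_lt_pi (hposs u hu) (by linarith [hlt u hu', Real.pi_pos])
    nlinarith [mul_pos this (invSpeed_pos ρ (z u).1)]
  have hxs : (z s).1 < b := by
    have := hanti ⟨le_rfl, hs0t.le⟩ ⟨hs0t.le, le_rfl⟩ hs0t
    simpa [hx0] using this
  have hcl := h.clairaut hρ hpos (hmem s ⟨hs0t.le, hs.2⟩)
  rw [hs0, hθ0, Real.cos_zero, mul_one, mul_one, hx0] at hcl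
  have hg := hgrow (z s).1 ⟨hax s ⟨hs0t.le, hs.2.trans ht.2⟩, hxs.le⟩
  rw [hcl] at hg
  have : 1 < Real.exp (b - (z s).1) := Real.one_lt_exp_iff.2 (by linarith)
  nlinarith [hpos b]

/-- At the turning point `x'` vanishes, so `b - x` itself has no positive lower bound on its rate;
its square root does, since `sin θ ≥ √(b - x)`. -/
theorem sq_le_of_le (h : IsUnitSolution ρ z T) (hρ : ContDiff ℝ ∞ ρ) (hpos : ∀ x, 0 < ρ x)
    (hab : a < b) (hba : b ≤ a + 1 / 2) (hx0 : (z 0).1 = b) (hθ0 : (z 0).2.1 = 0)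
    (hgrow : ∀ y ∈ Icc a b, ρ b * Real.exp (b - y) ≤ ρ y)
    (hK0 : 0 < K) (hK : ∀ y ∈ Icc a b, 1 ≤ K * invSpeed ρ y)
    {τ : ℝ} (hτ : 0 ≤ τ) (hτT : τ < T) (hax : ∀ t ∈ Icc 0 τ, a ≤ (z t).1) :
    (∀ t ∈ Icc 0 τ, (z t).1 ≤ b) ∧ τ / (2 * K) ≤ √(b - (z τ).1) := by
  have hmem : ∀ u ∈ Icc 0 τ, u ∈ Ioo (-T) T := fun u hu =>
    ⟨by linarith [hu.1, hu.2], by linarith [hu.2]⟩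
  have hθ := h.angle_pos hρ hpos hab hx0 hθ0 hgrow hτT hax
  have hsin : ∀ u ∈ Ioc 0 τ, 0 < Real.sin (z u).2.1 := fun u hu =>
    Real.sin_pos_of_pos_of_lt_pi (hθ u hu).1 (by linarith [(hθ u hu).2, Real.pi_pos])
  have hcx : ContinuousOn (fun s => (z s).1) (Icc 0 τ) := fun u hu =>
    (h.hasDerivAt_x (hmem u hu)).continuousAt.continuousWithinAt
  have hanti : StrictAntiOn (fun s => (z s).1) (Icc 0 τ) := by
    refine strictAntiOn_of_deriv_neg (convex_Icc 0 τ) hcx ?_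
    intro u hu
    rw [interior_Icc] at hu
    rw [(h.hasDerivAt_x (hmem u ⟨hu.1.le, hu.2.le⟩)).deriv]
    nlinarith [mul_pos (hsin u ⟨hu.1, hu.2.le⟩) (invSpeed_pos ρ (z u).1)]
  have hxb : ∀ t ∈ Icc 0 τ, (z t).1 ≤ b := fun t ht => by
    have := hanti.antitoneOn ⟨le_rfl, hτ⟩ ht ht.1
    simpa [hx0] using this
  refine ⟨hxb, ?_⟩
  have hmono : MonotoneOn (fun s => √(b - (z s).1) - s / (2 * K)) (Icc 0 τ) := by
    refine monotoneOn_of_hasDerivWithinAt_nonneg (convex_Icc 0 τ)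
      (f' := fun u => Real.sin (z u).2.1 * invSpeed ρ (z u).1 / (2 * √(b - (z u).1))
        - 1 / (2 * K)) ?_ ?_ ?_
    · exact ((continuousOn_const.sub hcx).sqrt).sub (continuousOn_id.div_const _)
    · intro u hu
      rw [interior_Icc] at hu
      have hlt : (z u).1 < b := by
        have := hanti ⟨le_rfl, hτ⟩ ⟨hu.1.le, hu.2.le⟩ hu.1
        simpa [hx0] using this
      have hd := (((h.hasDerivAt_x (hmem u ⟨hu.1.le, hu.2.le⟩)).const_sub b).sqrt
        (by linarith)).sub ((hasDerivAt_id u).div_const (2 * K))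
      refine (hd.congr_deriv ?_).hasDerivWithinAt
      ring
    · intro u hu
      rw [interior_Icc] at hu
      have hu' : u ∈ Icc 0 τ := ⟨hu.1.le, hu.2.le⟩
      have hlt : (z u).1 < b := by
        have := hanti ⟨le_rfl, hτ⟩ hu' hu.1
        simpa [hx0] using this
      have hI : (z u).1 ∈ Icc a b := ⟨hax u hu', hlt.le⟩
      have hs := hsin u ⟨hu.1, hu.2.le⟩
      have hcl := h.clairaut hρ hpos (hmem u hu')
      rw [hθ0, Real.cos_zero, mul_one, hx0] at hcl
      have hcos : Real.cos (z u).2.1 ≤ Real.exp (-(b - (z u).1)) := by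
        have hg := hgrow _ hI
        have hcp : 0 < Real.cos (z u).2.1 :=
          pos_of_mul_pos_right (hcl ▸ hpos _) (hpos _).le
        rw [Real.exp_neg, ← one_div, le_div_iff₀ (Real.exp_pos _)]
        rw [← hcl] at hg
        have hρu := hpos (z u).1
        by_contra! hc
        nlinarith [mul_lt_mul_of_pos_left hc hρu]
      have hcp : 0 < Real.cos (z u).2.1 :=
          pos_of_mul_pos_right (hcl ▸ hpos _) (hpos _).le
      -- `sin² θ = 1 - cos² θ ≥ 1 - e^{-2(b-x)} ≥ b - x`, the last step because `b - x ≤ 1/2`.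
      have hsq : √(b - (z u).1) ≤ Real.sin (z u).2.1 := by
        rw [Real.sqrt_le_left hs.le, Real.sin_sq]
        have h1 := le_one_sub_exp_sq (y := b - (z u).1) (by linarith) (by linarith [hI.1])
        have h2 := pow_le_pow_left₀ hcp.le hcos 2
        linarith
      have hsp : 0 < √(b - (z u).1) := Real.sqrt_pos.2 (by linarith)
      rw [sub_nonneg, div_le_div_iff₀ (by positivity) (by positivity)]
      have hA := invSpeed_pos ρ (z u).1
      have h3 := hK _ hI
      calc 1 * (2 * √(b - (z u).1)) ≤ (K * invSpeed ρ (z u).1) * (2 * Real.sin (z u).2.1) := by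
            gcongr
        _ = _ := by ring
  have := hmono ⟨le_rfl, hτ⟩ ⟨hτ, le_rfl⟩ hτ
  simp only [hx0, sub_self, Real.sqrt_zero, zero_div] at this
  linarith

/-- A unit speed geodesic that starts at a turning point `b` reaches `a` in bounded time. -/
theorem exists_reach (h : IsUnitSolution ρ z T) (hρ : ContDiff ℝ ∞ ρ) (hpos : ∀ x, 0 < ρ x)
    (hab : a < b) (hba : b ≤ a + 1 / 2) (hx0 : (z 0).1 = b) (hθ0 : (z 0).2.1 = 0)
    (hgrow : ∀ y ∈ Icc a b, ρ b * Real.exp (b - y) ≤ ρ y)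
    (hK0 : 0 < K) (hK : ∀ y ∈ Icc a b, 1 ≤ K * invSpeed ρ y) (hKT : 2 * K < T) :
    ∃ s ∈ Ioo 0 T, (z s).1 = a ∧ 0 < Real.sin (z s).2.1 ∧
      ∀ t ∈ Icc 0 s, (z t).1 ∈ Icc a b := by
  have hmem : ∀ u ∈ Icc 0 (2 * K), u ∈ Ioo (-T) T := fun u hu =>
    ⟨by linarith [hu.1, hu.2], by linarith [hu.2]⟩
  have hcx : ContinuousOn (fun s => (z s).1) (Icc 0 (2 * K)) := fun u hu =>
    (h.hasDerivAt_x (hmem u hu)).continuousAt.continuousWithinAt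
  obtain ⟨t, ht, hta⟩ : ∃ t ∈ Icc 0 (2 * K), (z t).1 ≤ a := by
    -- Staying above `a` up to time `2K` would give `b - x ≥ 1`, whereas `b - a ≤ 1/2`.
    by_contra! hne
    have := (h.sq_le_of_le hρ hpos hab hba hx0 hθ0 hgrow hK0 hK (by linarith) hKT
      fun t ht => (hne t ht).le).2
    rw [div_self (by positivity), Real.one_le_sqrt] at this
    linarith [hne (2 * K) ⟨by linarith, le_rfl⟩]
  obtain ⟨s, hs, hsa, hlt⟩ := exists_first_hit ht.1 (hcx.mono (Icc_subset_Icc_right ht.2))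
    (by simpa [hx0] using hab) hta
  have hsT : s < T := by linarith [hs.2, ht.2]
  have hax : ∀ u ∈ Icc 0 s, a ≤ (z u).1 := by
    intro u hu
    rcases hu.2.lt_or_eq with h1 | h1
    · exact (hlt u ⟨hu.1, h1⟩).le
    · rw [h1]; exact hsa.ge
  have hθ := h.angle_pos hρ hpos hab hx0 hθ0 hgrow hsT hax s ⟨hs.1, le_rfl⟩
  refine ⟨s, ⟨hs.1, hsT⟩, hsa, Real.sin_pos_of_pos_of_lt_pi hθ.1
    (by linarith [hθ.2, Real.pi_pos]), fun u hu => ⟨hax u hu, ?_⟩⟩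
  exact (h.sq_le_of_le hρ hpos hab hba hx0 hθ0 hgrow hK0 hK hs.1.le hsT hax).1 u hu

end IsUnitSolution

/-! ### The geodesic equation -/

theorem pd_comp_coord {f : ℝ → ℝ} {f' : ℝ} {q : Fin 3 → ℝ} (j i : Fin 3)
    (hf : HasDerivAt f f' (q j)) :
    pd i (fun y : Fin 3 → ℝ => f (y j)) q = if i = j then f' else 0 := by
  have h := hf.comp_hasFDerivAt q (hasFDerivAt_apply (𝕜 := ℝ) j q)
  change fderiv ℝ (f ∘ fun y : Fin 3 → ℝ => y j) q _ = _
  rw [h.fderiv]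
  by_cases hij : i = j
  · subst hij; simp
  · simp [hij]

theorem pd_const (i : Fin 3) (a : ℝ) (q : Fin 3 → ℝ) :
    pd i (fun _ : Fin 3 → ℝ => a) q = 0 := by
  simp [pd]

/-- The metric is diagonal with entries depending on `x` alone, so only the `x`-derivatives of two
entries contribute. -/
theorem geodesicEqAt_iff {r : ℝ → ℝ} (hr : ContDiff ℝ ∞ r) {c : ℝ → Fin 3 → ℝ} {t : ℝ}
    (hpos : r (c t 1) ≠ 0) :
    GeodesicEqAt (metricCoeff r) c t ↔
      deriv (deriv c) t 0 = 0 ∧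
      deriv (deriv c) t 1 + (1 + deriv r (c t 1) ^ 2)⁻¹ *
        (deriv r (c t 1) * deriv (deriv r) (c t 1) * deriv c t 1 ^ 2
          - r (c t 1) * deriv r (c t 1) * deriv c t 2 ^ 2) = 0 ∧
      deriv (deriv c) t 2 + 2 * (deriv r (c t 1) / r (c t 1)) * deriv c t 1 * deriv c t 2 = 0 := by
  have hd : Differentiable ℝ r := hr.differentiable (by simp)
  have hG : metricCoeff r = fun q =>
      Matrix.diagonal ![-1, 1 + deriv r (q 1) ^ 2, r (q 1) ^ 2] := funext (metricCoeff_eq hd)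
  have hr1 : ∀ x, HasDerivAt r (deriv r x) x := fun x => (hd x).hasDerivAt
  have hr2 : ∀ x, HasDerivAt (deriv r) (deriv (deriv r) x) x := fun x =>
    ((contDiff_deriv hr).differentiable (by simp) x).hasDerivAt
  set q := c t with hq
  have h1 : 1 + deriv r (q 1) ^ 2 ≠ 0 := by positivity
  have p1 : ∀ i, pd i (fun y : Fin 3 → ℝ => 1 + deriv r (y 1) ^ 2) q =
      if i = 1 then 2 * deriv r (q 1) * deriv (deriv r) (q 1) else 0 := fun i =>
    pd_comp_coord 1 i ((((hr2 (q 1)).pow 2).const_add 1).congr_deriv (by simp))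
  have p2 : ∀ i, pd i (fun y : Fin 3 → ℝ => r (y 1) ^ 2) q =
      if i = 1 then 2 * r (q 1) * deriv r (q 1) else 0 := fun i =>
    pd_comp_coord 1 i (((hr1 (q 1)).pow 2).congr_deriv (by simp))
  have hinv : (metricCoeff r q)⁻¹ =
      Matrix.diagonal ![-1, (1 + deriv r (q 1) ^ 2)⁻¹, (r (q 1) ^ 2)⁻¹] := by
    rw [hG]
    apply Matrix.inv_eq_right_inv
    rw [Matrix.diagonal_mul_diagonal, ← Matrix.diagonal_one]
    congr 1
    ext i
    fin_cases i
    · simp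
    · exact mul_inv_cancel₀ h1
    · exact mul_inv_cancel₀ (pow_ne_zero 2 hpos)
  unfold GeodesicEqAt
  simp only [christoffel, ← hq, hinv]
  rw [hG]
  simp only [Fin.forall_fin_succ, Fin.sum_univ_three, Matrix.diagonal_apply, Fin.isValue]
  simp [p1, p2, pd_const]
  refine fun _ => and_congr ?_ ?_
  · constructor <;> intro h <;> rw [← h] <;> ring
  · constructor <;> intro h <;> rw [← h] <;> field_simp <;> ring

theorem hasDerivAt_vec3 {f g h : ℝ → ℝ} {f' g' h' s : ℝ} (hf : HasDerivAt f f' s)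
    (hg : HasDerivAt g g' s) (hh : HasDerivAt h h' s) :
    HasDerivAt (fun s => ![f s, g s, h s]) ![f', g', h'] s := by
  rw [hasDerivAt_pi]
  intro i
  fin_cases i
  · exact hf
  · exact hg
  · exact hh

theorem deriv_eq_of_eqOn_Ioo {ρ r : ℝ → ℝ} {p q x : ℝ} (h : ∀ x ∈ Ioo p q, ρ x = r x)
    (hx : x ∈ Ioo p q) :
    deriv ρ x = deriv r x ∧ deriv (deriv ρ) x = deriv (deriv r) x := by
  have h1 : ∀ y ∈ Ioo p q, deriv ρ y = deriv r y := fun y hy =>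
    EventuallyEq.deriv_eq (mem_of_superset (isOpen_Ioo.mem_nhds hy) h)
  exact ⟨h1 x hx, EventuallyEq.deriv_eq (mem_of_superset (isOpen_Ioo.mem_nhds hx) h1)⟩

theorem differentiable_coords {r : ℝ → ℝ} (hr : Differentiable ℝ r) :
    Differentiable ℝ (coords r) := by
  have h1 : Differentiable ℝ fun q : Fin 3 → ℝ => r (q 1) := hr.comp (by fun_prop)
  refine Differentiable.prodMk (by fun_prop) ?_
  rw [differentiable_euclidean]
  intro i
  fin_cases i
  · change Differentiable ℝ fun q : Fin 3 → ℝ => q 1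
    fun_prop
  · change Differentiable ℝ fun q : Fin 3 → ℝ => r (q 1) * Real.cos (q 2)
    fun_prop
  · change Differentiable ℝ fun q : Fin 3 → ℝ => r (q 1) * Real.sin (q 2)
    fun_prop

/-- The curve in `M` given by a solution of the unit speed geodesic equation on `Σ`, with a
translate of its parameter as the time coordinate. -/
def lift (r : ℝ → ℝ) (t₀ : ℝ) (z : ℝ → ℝ × ℝ × ℝ) (s : ℝ) : ℝ × E3 :=
  coords r ![t₀ + s, (z s).1, (z s).2.2]

namespace IsUnitSolution

variable {r ρ : ℝ → ℝ} {z : ℝ → ℝ × ℝ × ℝ} {T δ t₀ : ℝ}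

theorem hasDerivAt_coordinates (h : IsUnitSolution ρ z T) {s : ℝ} (hs : s ∈ Ioo (-T) T) :
    HasDerivAt (fun s => ![t₀ + s, (z s).1, (z s).2.2])
      ![1, -Real.sin (z s).2.1 * invSpeed ρ (z s).1, Real.cos (z s).2.1 / ρ (z s).1] s :=
  hasDerivAt_vec3 ((hasDerivAt_id s).const_add t₀) (h.hasDerivAt_x hs) (h.hasDerivAt_longitude hs)

/-- Differentiating `x' = -A sin θ` and `φ' = cos θ / ρ` (with `A = invSpeed ρ`) gives the second
order equation. It involves the profile only up to its second derivative, so `ρ` may replace `r` on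
the open interval where they agree. -/
theorem isGeodesicOn (h : IsUnitSolution ρ z T) (hρ : ContDiff ℝ ∞ ρ) (hpos : ∀ x, 0 < ρ x)
    (hr : ContDiff ℝ ∞ r) (hδ : 0 < δ) (heq : ∀ x ∈ Ioo δ (1 - δ), ρ x = r x) {J : Set ℝ}
    (hJT : J ⊆ Ioo (-T) T) (hJ : ∀ s ∈ J, (z s).1 ∈ Ioo δ (1 - δ)) :
    IsGeodesicOn r (lift r t₀ z) J := by
  intro s hs
  have hsT := hJT hs
  have hx := hJ s hs
  have hev : ∀ᶠ u in 𝓝 s, (z u).1 ∈ Ioo δ (1 - δ) :=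
    (h.hasDerivAt_x hsT).continuousAt.eventually (isOpen_Ioo.mem_nhds hx)
  have hevT : ∀ᶠ u in 𝓝 s, u ∈ Ioo (-T) T := isOpen_Ioo.mem_nhds hsT
  refine ⟨fun s => ![t₀ + s, (z s).1, (z s).2.2], ?_, ?_, ?_⟩
  · have hz := contDiffAt_two_of_integralCurve ((contDiff_unitField hρ hpos).of_le (by simp))
      isOpen_Ioo h hsT
    rw [contDiffAt_pi]
    intro i
    fin_cases i
    · exact contDiffAt_const.add contDiffAt_id
    · exact contDiffAt_fst.comp s hz
    · exact contDiffAt_snd.comp s (contDiffAt_snd.comp s hz)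
  · filter_upwards [hev] with u hu
    refine ⟨⟨?_, ?_⟩, rfl⟩
    · exact hδ.trans hu.1
    · exact hu.2.trans (by linarith)
  · have hd : deriv (fun s => ![t₀ + s, (z s).1, (z s).2.2]) =ᶠ[𝓝 s] fun s =>
        ![1, -Real.sin (z s).2.1 * invSpeed ρ (z s).1, Real.cos (z s).2.1 / ρ (z s).1] := by
      filter_upwards [hevT] with u hu
      exact (h.hasDerivAt_coordinates hu).deriv
    have hρ1 : HasDerivAt ρ (deriv ρ (z s).1) (z s).1 :=
      (hρ.differentiable (by simp) _).hasDerivAt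
    have hd2 := hasDerivAt_vec3 (hasDerivAt_const s (1 : ℝ))
      ((h.hasDerivAt_angle hsT).sin.neg.mul
        ((hasDerivAt_invSpeed hρ _).comp s (h.hasDerivAt_x hsT)))
      ((h.hasDerivAt_angle hsT).cos.div (hρ1.comp s (h.hasDerivAt_x hsT)) (hpos _).ne')
    have hd2' := hd.deriv_eq.trans hd2.deriv
    obtain ⟨e1, e2⟩ := deriv_eq_of_eqOn_Ioo heq hx
    have hρx := (hpos (z s).1).ne'
    have e0 := heq _ hx
    rw [geodesicEqAt_iff hr (by simpa [← e0] using hρx), hd2', hd.eq_of_nhds]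
    simp only [Matrix.cons_val_zero, Matrix.cons_val_one, Matrix.cons_val, ← e0, ← e1, ← e2,
      Function.comp, Pi.neg_apply]
    have hA := invSpeed_sq ρ (z s).1
    have hAi : (1 + deriv ρ (z s).1 ^ 2)⁻¹ = invSpeed ρ (z s).1 ^ 2 :=
      (eq_inv_of_mul_eq_one_left hA).symm
    rw [hAi]
    refine ⟨trivial, ?_, ?_⟩ <;> field_simp <;> ring

theorem deriv_lift (h : IsUnitSolution ρ z T) (hr : ContDiff ℝ ∞ r) {s : ℝ}
    (hs : s ∈ Ioo (-T) T) :
    deriv (lift r t₀ z) s = fderiv ℝ (coords r) ![t₀ + s, (z s).1, (z s).2.2]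
      ![1, -Real.sin (z s).2.1 * invSpeed ρ (z s).1, Real.cos (z s).2.1 / ρ (z s).1] := by
  exact ((differentiable_coords (hr.differentiable (by simp)) _).hasFDerivAt.comp_hasDerivAt s
    (h.hasDerivAt_coordinates hs)).deriv

end IsUnitSolution

/-! ### Conservation laws -/

/-- The angular momentum about the axis of revolution. -/
def angularMomentum (p v : ℝ × E3) : ℝ := p.2 1 * v.2 2 - p.2 2 * v.2 1

theorem IsGeodesicOn.exists_coordinates {r : ℝ → ℝ} (hr : Differentiable ℝ r)
    {γ : ℝ → ℝ × E3} {J : Set ℝ} (h : IsGeodesicOn r γ J) {t : ℝ} (ht : t ∈ J) :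
    ∃ c : ℝ → Fin 3 → ℝ, ContDiffAt ℝ 2 c t ∧ c t ∈ coordDomain ∧
      GeodesicEqAt (metricCoeff r) c t ∧
      ∀ᶠ s in 𝓝 t, γ s = coords r (c s) ∧
        deriv γ s = fderiv ℝ (coords r) (c s) (deriv c s) := by
  obtain ⟨c, hc, hev, heq⟩ := h t ht
  refine ⟨c, hc, hev.self_of_nhds.1, heq, ?_⟩
  have hd : ∀ᶠ s in 𝓝 t, DifferentiableAt ℝ c s :=
    (hc.eventually (by simp)).mono fun s hs => hs.differentiableAt (by simp)
  filter_upwards [hev.eventually_nhds, hd] with s hs hds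
  refine ⟨hs.self_of_nhds.2, ?_⟩
  have : γ =ᶠ[𝓝 s] coords r ∘ c := hs.mono fun u hu => hu.2
  rw [this.deriv_eq]
  exact ((differentiable_coords hr _).hasFDerivAt.comp_hasDerivAt s hds.hasDerivAt).deriv

/-- The ambient definition makes the quantity independent of the local coordinate curve, which may
change from one parameter to the next. -/
theorem angularMomentum_coords {r : ℝ → ℝ} (hr : Differentiable ℝ r) (q u : Fin 3 → ℝ) :
    angularMomentum (coords r q) (fderiv ℝ (coords r) q u) = r (q 1) ^ 2 * u 2 := by
  rw [fderiv_coords_apply hr]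
  simp [angularMomentum, coords, param]
  linear_combination r (q 1) ^ 2 * u 2 * Real.sin_sq_add_cos_sq (q 2)

theorem inner_coords {r : ℝ → ℝ} (hr : Differentiable ℝ r) (q u : Fin 3 → ℝ) :
    inner ℝ (fderiv ℝ (coords r) q u).2 (fderiv ℝ (coords r) q u).2 =
      (1 + deriv r (q 1) ^ 2) * u 1 ^ 2 + r (q 1) ^ 2 * u 2 ^ 2 := by
  rw [fderiv_coords_apply hr]
  simp only [PiLp.inner_apply, Fin.sum_univ_three, RCLike.inner_apply, conj_trivial]
  simp [-abs_mul_abs_self]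
  linear_combination ((deriv r (q 1) * u 1) ^ 2 + r (q 1) ^ 2 * u 2 ^ 2) *
    Real.sin_sq_add_cos_sq (q 2)

/-- The derivatives of the conserved quantities vanish. -/
theorem IsGeodesicOn.hasDerivAt_conserved {r : ℝ → ℝ} (hr : ContDiff ℝ ∞ r)
    (hpos : ∀ x ∈ Ioo (0 : ℝ) 1, 0 < r x)
    {γ : ℝ → ℝ × E3} {J : Set ℝ} (h : IsGeodesicOn r γ J) {t : ℝ} (ht : t ∈ J) :
    HasDerivAt (fun s => angularMomentum (γ s) (deriv γ s)) 0 t ∧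
    HasDerivAt (fun s => inner ℝ (deriv γ s).2 (deriv γ s).2) 0 t ∧
    ContinuousAt (fun s => (deriv γ s).2 0) t := by
  have hrd : Differentiable ℝ r := hr.differentiable (by simp)
  obtain ⟨c, hc, hct, heq, hev⟩ := h.exists_coordinates hrd ht
  have hrt : r (c t 1) ≠ 0 := (hpos _ hct).ne'
  rw [geodesicEqAt_iff hr hrt] at heq
  obtain ⟨-, hx, hφ⟩ := heq
  have hc1 : HasDerivAt c (deriv c t) t := (hc.differentiableAt (by simp)).hasDerivAt
  have hc2 : HasDerivAt (deriv c) (deriv (deriv c) t) t :=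
    ((hc.derivWithin (m := 1) (by norm_num)).differentiableAt (by simp)).hasDerivAt
  have c1 := fun i => hasDerivAt_pi.1 hc1 i
  have c2 := fun i => hasDerivAt_pi.1 hc2 i
  have hr1 : HasDerivAt r (deriv r (c t 1)) (c t 1) := (hrd _).hasDerivAt
  have hr2 : HasDerivAt (deriv r) (deriv (deriv r) (c t 1)) (c t 1) :=
    ((contDiff_deriv hr).differentiable (by simp) _).hasDerivAt
  have k1 := hr1.comp t (c1 1)
  have k2 := hr2.comp t (c1 1)
  have hne : 1 + deriv r (c t 1) ^ 2 ≠ 0 := by positivity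
  refine ⟨?_, ?_, ?_⟩
  · have h1 : HasDerivAt (fun s => r (c s 1) ^ 2 * deriv c s 2) 0 t := by
      refine ((k1.pow 2).mul (c2 2)).congr_deriv ?_
      simp only [Function.comp, Pi.pow_apply]
      field_simp at hφ
      linear_combination r (c t 1) * hφ
    refine h1.congr_of_eventuallyEq ?_
    filter_upwards [hev] with s hs
    rw [hs.1, hs.2, angularMomentum_coords hrd]
  · have h1 : HasDerivAt (fun s => (1 + deriv r (c s 1) ^ 2) * deriv c s 1 ^ 2
        + r (c s 1) ^ 2 * deriv c s 2 ^ 2) 0 t := by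
      refine ((((k2.pow 2).const_add 1).mul ((c2 1).pow 2)).add
        ((k1.pow 2).mul ((c2 2).pow 2))).congr_deriv ?_
      simp only [Function.comp, Pi.pow_apply]
      field_simp at hφ hx
      linear_combination 2 * deriv c t 1 * hx + 2 * r (c t 1) * deriv c t 2 * hφ
    refine h1.congr_of_eventuallyEq ?_
    filter_upwards [hev] with s hs
    rw [hs.2, inner_coords hrd]
  · refine (c2 1).continuousAt.congr ?_
    filter_upwards [hev] with s hs
    rw [hs.2, fderiv_coords_apply hrd]
    rfl

/-! ### Radial null vectors and the invariant separating them -/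

theorem IsGeodesicOn.conserved {r : ℝ → ℝ} (hr : ContDiff ℝ ∞ r)
    (hpos : ∀ x ∈ Ioo (0 : ℝ) 1, 0 < r x)
    {γ : ℝ → ℝ × E3} {J : Set ℝ} (h : IsGeodesicOn r γ J) (hJ : IsOpen J)
    (hJc : J.OrdConnected) {s t : ℝ} (hs : s ∈ J) (ht : t ∈ J) :
    angularMomentum (γ s) (deriv γ s) = angularMomentum (γ t) (deriv γ t) ∧
    inner ℝ (deriv γ s).2 (deriv γ s).2 = inner ℝ (deriv γ t).2 (deriv γ t).2 := by
  have hc := fun u (hu : u ∈ J) => h.hasDerivAt_conserved hr hpos hu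
  constructor
  · exact hJ.is_const_of_deriv_eq_zero hJc.isPreconnected
      (fun u hu => (hc u hu).1.differentiableAt.differentiableWithinAt)
      (fun u hu => (hc u hu).1.deriv) hs ht
  · exact hJ.is_const_of_deriv_eq_zero hJc.isPreconnected
      (fun u hu => (hc u hu).2.1.differentiableAt.differentiableWithinAt)
      (fun u hu => (hc u hu).2.1.deriv) hs ht

/-- A geodesic that is not constant on `Σ` and has no angular momentum moves monotonically along the
axis of revolution. -/
theorem IsGeodesicOn.axial_velocity_pos {r : ℝ → ℝ} (hr : ContDiff ℝ ∞ r)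
    (hpos : ∀ x ∈ Ioo (0 : ℝ) 1, 0 < r x)
    {γ : ℝ → ℝ × E3} {J : Set ℝ} (h : IsGeodesicOn r γ J) (hJ : IsOpen J)
    (hJc : J.OrdConnected) {s t : ℝ} (hs : s ∈ J) (ht : t ∈ J)
    (hℓ : angularMomentum (γ s) (deriv γ s) = 0)
    (hE : 0 < inner ℝ (deriv γ s).2 (deriv γ s).2) (hv : 0 < (deriv γ s).2 0) :
    0 < (deriv γ t).2 0 := by
  have hrd : Differentiable ℝ r := hr.differentiable (by simp)
  -- Without angular momentum, a zero of the axial velocity would make the conserved spatial energy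
  -- vanish; so the sign cannot change.
  have hne : ∀ u ∈ J, (deriv γ u).2 0 ≠ 0 := by
    intro u hu h0
    obtain ⟨h1, h2⟩ := h.conserved hr hpos hJ hJc hs hu
    obtain ⟨c, -, hct, -, hev⟩ := h.exists_coordinates hrd hu
    obtain ⟨e1, e2⟩ := hev.self_of_nhds
    rw [hℓ, e1, e2, angularMomentum_coords hrd] at h1
    rw [h2, e2, inner_coords hrd] at hE
    rw [e2, fderiv_coords_apply hrd] at h0
    have h0' : deriv c u 1 = 0 := h0
    have hru : r (c u 1) ^ 2 ≠ 0 := pow_ne_zero 2 (hpos _ hct).ne'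
    have h2' : deriv c u 2 = 0 := (mul_eq_zero.1 h1.symm).resolve_left hru
    rw [h0', h2'] at hE
    simp at hE
  by_contra! hle
  have hcont : ContinuousOn (fun u => (deriv γ u).2 0) J := fun u hu =>
    (h.hasDerivAt_conserved hr hpos hu).2.2.continuousWithinAt
  obtain ⟨u, hu, hu0⟩ := hJc.isPreconnected.intermediate_value ht hs hcont ⟨hle, hv.le⟩
  exact hne u hu hu0

/-- The null vector projects to an outgoing (in the direction of increasing `x`) vector tangent to a
meridian. -/
def IsOutgoing {r : ℝ → ℝ} (v : FutureNullCone r) : Prop :=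
  angularMomentum v.1.1 v.1.2 = 0 ∧ 0 < v.1.2.2 0

/-- For a null vector the spatial square equals the square of the time component, which is positive
by future direction. -/
theorem inner_pos {r : ℝ → ℝ} (v : FutureNullCone r) : 0 < inner ℝ v.1.2.2 v.1.2.2 := by
  obtain ⟨v, -, -, h0, -, h1⟩ := v
  simp only [lorentz, inner_zero_left, add_zero] at h0 h1
  nlinarith

theorem SameLeaf.isOutgoing_iff {r : ℝ → ℝ} (hr : ContDiff ℝ ∞ r)
    (hpos : ∀ x ∈ Ioo (0 : ℝ) 1, 0 < r x) {v w : FutureNullCone r} (h : SameLeaf r v w) :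
    IsOutgoing v ↔ IsOutgoing w := by
  obtain ⟨γ, J, hJ, hJc, hγ, s, hs, t, ht, a, ha, ⟨hv, hv'⟩, hw, hw'⟩ := h
  obtain ⟨h1, h2⟩ := hγ.conserved hr hpos hJ hJc hs ht
  have hE : 0 < inner ℝ (deriv γ s).2 (deriv γ s).2 := by rw [hv']; exact inner_pos v
  have hℓ : angularMomentum (γ t) (deriv γ t) = a * angularMomentum w.1.1 w.1.2 := by
    rw [hw, hw']
    simp only [angularMomentum, Prod.smul_snd, PiLp.smul_apply, smul_eq_mul]
    ring
  have hx : (deriv γ t).2 0 = a * w.1.2.2 0 := by rw [hw']; rfl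
  constructor
  · rintro ⟨hv0, hvp⟩
    rw [← hv, ← hv'] at hv0
    rw [← hv'] at hvp
    have := hγ.axial_velocity_pos hr hpos hJ hJc hs ht hv0 hE hvp
    rw [hv0, hℓ] at h1
    rw [hx] at this
    exact ⟨(mul_eq_zero.1 h1.symm).resolve_left ha.ne', pos_of_mul_pos_right this ha.le⟩
  · rintro ⟨hw0, hwp⟩
    have ht0 : angularMomentum (γ t) (deriv γ t) = 0 := by rw [hℓ, hw0, mul_zero]
    have := hγ.axial_velocity_pos hr hpos hJ hJc ht hs ht0 (h2 ▸ hE)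
      (by rw [hx]; positivity)
    rw [ht0, hv, hv'] at h1
    rw [hv'] at this
    exact ⟨h1, this⟩

/-- The predicate descends to the quotient, so no transitivity of `SameLeaf` has to be checked. -/
theorem isOutgoing_iff_of_toNullGeodesic_eq {r : ℝ → ℝ} (hr : ContDiff ℝ ∞ r)
    (hpos : ∀ x ∈ Ioo (0 : ℝ) 1, 0 < r x) {v w : FutureNullCone r}
    (h : toNullGeodesic v = toNullGeodesic w) : IsOutgoing v ↔ IsOutgoing w := by
  have := congrArg (Quot.lift IsOutgoing fun _ _ h => propext (h.isOutgoing_iff hr hpos)) h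
  exact iff_of_eq this

/-! ### Null vectors over the parallel `x = 1/2`. -/

theorem continuous_toNullGeodesic {r : ℝ → ℝ} :
    Continuous (toNullGeodesic : FutureNullCone r → NullGeodesicSpace r) :=
  continuous_quot_mk

theorem continuous_vec3 {X : Type*} [TopologicalSpace X] {f g h : X → ℝ} (hf : Continuous f)
    (hg : Continuous g) (hh : Continuous h) :
    Continuous fun x => (!₂[f x, g x, h x] : E3) := by
  refine (PiLp.continuous_toLp 2 _).comp (continuous_pi fun i => ?_)
  fin_cases i
  · exact hf
  · exact hg
  · exact hh

/-- The null vectors over the parallel `x = 1/2`, parametrized by the time, the longitude, and the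
angle `θ` of the projection to `Σ` with the parallel. -/
def nullVector {r : ℝ → ℝ} (hr : ContDiff ℝ ∞ r) (hpos : ∀ x ∈ Ioo (0 : ℝ) 1, 0 < r x)
    (p : ℝ × ℝ × ℝ) : FutureNullCone r :=
  ⟨(coords r ![p.1, 1 / 2, p.2.1], fderiv ℝ (coords r) ![p.1, 1 / 2, p.2.1]
      ![1, -Real.sin p.2.2 * invSpeed r (1 / 2), Real.cos p.2.2 / r (1 / 2)]), by
    have hrd : Differentiable ℝ r := hr.differentiable (by simp)
    have hmem : (1 / 2 : ℝ) ∈ Ioo (0 : ℝ) 1 := by norm_num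
    have h1 : r (1 / 2) ≠ 0 := (hpos _ hmem).ne'
    refine ⟨⟨trivial, 1 / 2, hmem, p.2.1, rfl⟩, ⟨_, hmem, rfl, _, rfl⟩, ?_, ?_, ?_⟩
    · have hA := invSpeed_sq r (1 / 2)
      have h2 := inner_coords hrd ![p.1, 1 / 2, p.2.1]
        ![1, -Real.sin p.2.2 * invSpeed r (1 / 2), Real.cos p.2.2 / r (1 / 2)]
      rw [lorentz, h2, fderiv_coords_apply hrd]
      simp only [Matrix.cons_val_zero, Matrix.cons_val_one, Matrix.cons_val]
      have hsc := Real.sin_sq_add_cos_sq p.2.2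
      field_simp at hA ⊢
      linear_combination Real.sin p.2.2 ^ 2 * hA + hsc
    · intro h
      have := congrArg Prod.fst h
      rw [fderiv_coords_apply hrd] at this
      simp at this
    · rw [lorentz, fderiv_coords_apply hrd]
      simp⟩

section nullVector

variable {r : ℝ → ℝ} (hr : ContDiff ℝ ∞ r) (hpos : ∀ x ∈ Ioo (0 : ℝ) 1, 0 < r x)

theorem continuous_nullVector : Continuous (nullVector hr hpos) := by
  refine Continuous.subtype_mk ?_ _
  simp only [fderiv_coords_apply (hr.differentiable (by simp)), coords, param]
  refine Continuous.prodMk (Continuous.prodMk ?_ (continuous_vec3 ?_ ?_ ?_))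
    (Continuous.prodMk ?_ (continuous_vec3 ?_ ?_ ?_)) <;>
  · simp only [Matrix.cons_val_zero, Matrix.cons_val_one, Matrix.cons_val]
    fun_prop

/-- Allows both angles to be reduced to `[0, 2π]`, which provides compactness. -/
theorem nullVector_congr {t φ θ φ' θ' : ℝ} (h1 : Real.cos φ' = Real.cos φ)
    (h2 : Real.sin φ' = Real.sin φ) (h3 : Real.cos θ' = Real.cos θ)
    (h4 : Real.sin θ' = Real.sin θ) :
    nullVector hr hpos (t, φ', θ') = nullVector hr hpos (t, φ, θ) := by
  apply Subtype.ext
  simp [nullVector, fderiv_coords_apply (hr.differentiable (by simp)), coords, param, h1, h2, h3,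
    h4]

theorem isOutgoing_nullVector_iff {t φ θ : ℝ} (h : Real.cos θ = 0) :
    IsOutgoing (nullVector hr hpos (t, φ, θ)) ↔ Real.sin θ < 0 := by
  have hrd : Differentiable ℝ r := hr.differentiable (by simp)
  have hA := invSpeed_pos r (1 / 2)
  have h1 : angularMomentum (nullVector hr hpos (t, φ, θ)).1.1 (nullVector hr hpos (t, φ, θ)).1.2
      = 0 := by
    refine (angularMomentum_coords hrd _ _).trans ?_
    simp [h]
  have h2 : (nullVector hr hpos (t, φ, θ)).1.2.2 0 = -Real.sin θ * invSpeed r (1 / 2) := by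
    simp only [nullVector, fderiv_coords_apply hrd]
    rfl
  rw [IsOutgoing, h1, h2, mul_pos_iff_of_pos_right hA, neg_pos]
  simp

theorem isVelocity_lift {ρ : ℝ → ℝ} {z : ℝ → ℝ × ℝ × ℝ} {T δ t₀ s : ℝ}
    (h : IsUnitSolution ρ z T) (heq : ∀ x ∈ Ioo δ (1 - δ), ρ x = r x) (hδ : δ < 1 / 2)
    (hs : s ∈ Ioo (-T) T) (hz : (z s).1 = 1 / 2) :
    IsVelocity (lift r t₀ z) s (nullVector hr hpos (t₀ + s, (z s).2.2, (z s).2.1)) := by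
  have hm : (1 / 2 : ℝ) ∈ Ioo δ (1 - δ) := ⟨hδ, by linarith⟩
  refine ⟨by rw [lift, hz]; rfl, ?_⟩
  rw [h.deriv_lift hr hs, hz, heq _ hm]
  unfold invSpeed
  rw [(deriv_eq_of_eqOn_Ioo heq hm).1]
  rfl

end nullVector

/-- An open interval of times around `[p, q]` in which `x` stays in the interval `(δ, 1 - δ)`. -/
theorem exists_open_interval {x : ℝ → ℝ} {T δ p q : ℝ} (hx : ContinuousOn x (Ioo (-T) T))
    (hpq : p ≤ q) (hp : -T < p) (hq : q < T) (hI : ∀ t ∈ Icc p q, x t ∈ Ioo δ (1 - δ)) :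
    ∃ J : Set ℝ, IsOpen J ∧ J.OrdConnected ∧ Icc p q ⊆ J ∧ J ⊆ Ioo (-T) T ∧
      ∀ t ∈ J, x t ∈ Ioo δ (1 - δ) := by
  have hU := hx.isOpen_inter_preimage isOpen_Ioo (isOpen_Ioo (a := δ) (b := 1 - δ))
  have hsub : Icc p q ⊆ Ioo (-T) T ∩ x ⁻¹' Ioo δ (1 - δ) := fun t ht =>
    ⟨⟨by linarith [ht.1], by linarith [ht.2]⟩, hI t ht⟩
  -- The component of `p` in the open set of admissible times is open, order-connected and contains
  -- `[p, q]`.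
  have hJ := connectedComponentIn_subset (Ioo (-T) T ∩ x ⁻¹' Ioo δ (1 - δ)) p
  exact ⟨connectedComponentIn (Ioo (-T) T ∩ x ⁻¹' Ioo δ (1 - δ)) p, hU.connectedComponentIn,
    isPreconnected_connectedComponentIn.ordConnected,
    isPreconnected_Icc.subset_connectedComponentIn ⟨le_rfl, hpq⟩ hsub,
    fun t ht => (hJ ht).1, fun t ht => (hJ ht).2⟩

section nullVector

variable {r : ℝ → ℝ} (hr : ContDiff ℝ ∞ r) (hpos : ∀ x ∈ Ioo (0 : ℝ) 1, 0 < r x)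

/-- By Clairaut `cos θ` stays zero, hence the longitude is constant. -/
theorem isOverMeridian_nullVector {t φ θ : ℝ} (hθ : Real.cos θ = 0) :
    IsOverMeridian (toNullGeodesic (nullVector hr hpos (t, φ, θ))) := by
  obtain ⟨ρ, hρ, hρpos, hcs, heq⟩ := exists_cutoff hr hpos (δ := 1 / 4) (by norm_num) (by norm_num)
  obtain ⟨z, hz0, hz⟩ := exists_isUnitSolution hρ hρpos hcs (1 / 2, θ, φ) one_pos
  have h0 : (0 : ℝ) ∈ Ioo (-1 : ℝ) 1 := by norm_num
  obtain ⟨J, hJ, hJc, h0J, hJT, hJx⟩ := exists_open_interval (x := fun s => (z s).1) (T := 1)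
    (δ := 1 / 4) (p := 0) (q := 0)
    (fun s hs => (hz.hasDerivAt_x hs).continuousAt.continuousWithinAt) le_rfl
    (by norm_num) (by norm_num) (by
      intro s hs
      obtain rfl : s = 0 := le_antisymm hs.2 hs.1
      simp only [hz0]
      norm_num)
  have hcos : ∀ s ∈ Ioo (-1 : ℝ) 1, Real.cos (z s).2.1 = 0 := by
    intro s hs
    have := hz.clairaut hρ hρpos hs
    rw [hz0] at this
    simp only [hθ, mul_zero] at this
    exact (mul_eq_zero.1 this).resolve_left (hρpos _).ne'
  have hφ : ∀ s ∈ Ioo (-1 : ℝ) 1, (z s).2.2 = φ := by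
    intro s hs
    have := isOpen_Ioo.is_const_of_deriv_eq_zero isPreconnected_Ioo
      (fun t ht => (hz.hasDerivAt_longitude ht).differentiableAt.differentiableWithinAt)
      (fun t ht => by
        rw [(hz.hasDerivAt_longitude ht).deriv, hcos t ht, zero_div]; rfl) hs h0
    simpa [hz0] using this
  refine ⟨lift r t z, J, φ, hJ, hJc,
    hz.isGeodesicOn hρ hρpos hr (by norm_num) heq hJT hJx, ?_, 0, h0J ⟨le_rfl, le_rfl⟩,
    nullVector hr hpos (t, φ, θ), ?_, rfl⟩
  · intro s hs
    have hx := hJx s hs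
    refine ⟨(z s).1, ⟨by linarith [hx.1], by linarith [hx.2]⟩, ?_⟩
    simp [lift, coords, hφ s (hJT hs)]
  · have := isVelocity_lift hr hpos (t₀ := t) hz heq (by norm_num) h0 (by rw [hz0])
    simpa [hz0] using this

end nullVector

/-! ### Bouncing geodesics and their two limits. -/

theorem exists_turning_point {r : ℝ → ℝ} (hr : Continuous r)
    (hpos : ∀ x ∈ Ioo (0 : ℝ) 1, 0 < r x) (h1 : r 1 = 0) {ε : ℝ} (hε : 0 < ε) :
    ∃ b ∈ Ioo (1 / 2 : ℝ) 1, r b < ε ∧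
      ∀ y ∈ Icc (1 / 2) b, r b * Real.exp (b - y) ≤ r y := by
  have hg : Continuous fun y => r y * Real.exp y := by fun_prop
  have hhalf : 0 < r (1 / 2) * Real.exp (1 / 2) :=
    mul_pos (hpos _ (by norm_num)) (Real.exp_pos _)
  have hlim : Tendsto (fun y => r y * Real.exp y) (𝓝[<] 1) (𝓝 0) := by
    have := hg.tendsto 1
    rw [h1, zero_mul] at this
    exact this.mono_left nhdsWithin_le_nhds
  -- `b` will minimise `r(y) e^y` on `[1/2, y₀]`. The bound by the value at `1/2` keeps `b` away
  -- from that endpoint; the bound by `ε` gives `r(b) < ε`, as `e^b ≥ 1`.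
  obtain ⟨y₀, hy₀, hy₀I⟩ := ((hlim.eventually_lt_const (lt_min hε hhalf)).and
    (Ioo_mem_nhdsLT (show (1 / 2 : ℝ) < 1 by norm_num))).exists
  obtain ⟨b, hb, hmin⟩ := isCompact_Icc.exists_isMinOn (nonempty_Icc.2 hy₀I.1.le)
    hg.continuousOn
  have hbb := hmin (show y₀ ∈ Icc (1 / 2) y₀ from ⟨hy₀I.1.le, le_rfl⟩)
  simp only [mem_ofPred_eq] at hbb
  have hb1 : b < 1 := hb.2.trans_lt hy₀I.2
  have hlt := lt_min_iff.1 hy₀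
  have hb2 : 1 / 2 < b := by
    refine lt_of_le_of_ne hb.1 ?_
    rintro rfl
    linarith [hlt.2]
  have hrb : 0 < r b := hpos b ⟨by linarith, hb1⟩
  refine ⟨b, ⟨hb2, hb1⟩, ?_, fun y hy => ?_⟩
  · have : 1 ≤ Real.exp b := Real.one_le_exp (by linarith)
    nlinarith [hlt.1]
  · have h := hmin (show y ∈ Icc (1 / 2) y₀ from ⟨hy.1, hy.2.trans hb.2⟩)
    simp only [mem_ofPred_eq] at h
    rw [Real.exp_sub, ← mul_div_assoc, div_le_iff₀ (Real.exp_pos _)]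
    exact h

theorem exists_mem_Icc_cos_sin_eq (x : ℝ) :
    ∃ y ∈ Icc 0 (2 * Real.pi), Real.cos y = Real.cos x ∧ Real.sin y = Real.sin x := by
  have h := toIcoMod_mem_Ico Real.two_pi_pos 0 x
  rw [zero_add] at h
  refine ⟨toIcoMod Real.two_pi_pos 0 x, ⟨h.1, h.2.le⟩, ?_, ?_⟩
  · exact Real.cos_periodic.sub_zsmul_eq _
  · exact Real.sin_periodic.sub_zsmul_eq _

theorem exists_one_le_mul_invSpeed {r : ℝ → ℝ} (hr : ContDiff ℝ ∞ r) :
    ∃ K, 0 < K ∧ ∀ y ∈ Icc (0 : ℝ) 1, 1 ≤ K * invSpeed r y := by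
  obtain ⟨y, -, hmin⟩ := isCompact_Icc.exists_isMinOn (nonempty_Icc.2 zero_le_one)
    ((contDiff_invSpeed hr).continuous.continuousOn (s := Icc (0 : ℝ) 1))
  refine ⟨(invSpeed r y)⁻¹, inv_pos.2 (invSpeed_pos r y), fun x hx => ?_⟩
  rw [← div_eq_inv_mul, one_le_div (invSpeed_pos r y)]
  exact hmin hx

section nullVector

variable {r : ℝ → ℝ} (hr : ContDiff ℝ ∞ r) (hpos : ∀ x ∈ Ioo (0 : ℝ) 1, 0 < r x)

/-- There are null geodesics with small angular momentum which bounce off the end `x = 1` and return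
to the parallel `x = 1/2` after a bounded time. -/
theorem exists_bounce (h1 : r 1 = 0) {K : ℝ} (hK0 : 0 < K)
    (hK : ∀ y ∈ Icc (0 : ℝ) 1, 1 ≤ K * invSpeed r y) {ε : ℝ} (hε : 0 < ε) :
    ∃ p ∈ Icc ((-(2 * K + 1), 0, 0) : ℝ × ℝ × ℝ) (2 * K + 1, 2 * Real.pi, 2 * Real.pi),
    ∃ q ∈ Icc ((-(2 * K + 1), 0, 0) : ℝ × ℝ × ℝ) (2 * K + 1, 2 * Real.pi, 2 * Real.pi),
      toNullGeodesic (nullVector hr hpos p) = toNullGeodesic (nullVector hr hpos q) ∧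
      |r (1 / 2) * Real.cos p.2.2| < ε ∧ |r (1 / 2) * Real.cos q.2.2| < ε ∧
      Real.sin p.2.2 ≤ 0 ∧ 0 ≤ Real.sin q.2.2 := by
  obtain ⟨b, hb, hbε, hgrow⟩ := exists_turning_point hr.continuous hpos h1 hε
  -- With `δ = (1 - b)/2` the interval `(δ, 1 - δ)` contains `[1/2, b]`, so the cutoff does not
  -- affect the bounce.
  have hδ : 0 < (1 - b) / 2 := by linarith [hb.2]
  have hδ' : (1 - b) / 2 < 1 / 2 := by linarith [hb.1]
  obtain ⟨ρ, hρ, hρpos, hcs, heq⟩ := exists_cutoff hr hpos hδ hδ'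
  have hsub : Icc (1 / 2) b ⊆ Ioo ((1 - b) / 2) (1 - (1 - b) / 2) := fun y hy =>
    ⟨by linarith [hy.1, hb.1], by linarith [hy.2, hb.2]⟩
  have hbI : b ∈ Icc (1 / 2) b := ⟨hb.1.le, le_rfl⟩
  have hgrow' : ∀ y ∈ Icc (1 / 2) b, ρ b * Real.exp (b - y) ≤ ρ y := by
    intro y hy
    rw [heq _ (hsub hbI), heq _ (hsub hy)]
    exact hgrow y hy
  have hKρ : ∀ y ∈ Icc (1 / 2) b, 1 ≤ K * invSpeed ρ y := by
    intro y hy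
    have := hK y ⟨by linarith [hy.1], by linarith [hy.2, hb.2]⟩
    unfold invSpeed at this ⊢
    rwa [(deriv_eq_of_eqOn_Ioo heq (hsub hy)).1]
  obtain ⟨z, hz0, hz⟩ := exists_isUnitSolution hρ hρpos hcs (b, 0, 0)
    (show 0 < 2 * K + 1 by linarith)
  have hba : b ≤ 1 / 2 + 1 / 2 := by linarith [hb.2]
  obtain ⟨s, hs, hsx, hsin, hsI⟩ := hz.exists_reach hρ hρpos hb.1 hba (by rw [hz0])
    (by rw [hz0]) hgrow' hK0 hKρ (by linarith)
  -- The initial state `(b, 0, 0)` is fixed by time reversal, so the same estimate applies to the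
  -- past.
  obtain ⟨t, ht, htx, htin, htI⟩ := hz.reverse.exists_reach hρ hρpos hb.1 hba
    (by simp [hz0]) (by simp [hz0]) hgrow' hK0 hKρ (by linarith)
  simp only [Real.sin_neg] at htx htin htI
  have hs' : s ∈ Ioo (-(2 * K + 1)) (2 * K + 1) := ⟨by linarith [hs.1], hs.2⟩
  have ht' : -t ∈ Ioo (-(2 * K + 1)) (2 * K + 1) := ⟨by linarith [ht.2], by linarith [ht.1]⟩
  obtain ⟨J, hJ, hJc, hIJ, hJT, hJx⟩ := exists_open_interval (x := fun s => (z s).1)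
    (T := 2 * K + 1) (δ := (1 - b) / 2) (p := -t) (q := s)
    (fun u hu => (hz.hasDerivAt_x hu).continuousAt.continuousWithinAt)
    (by linarith [hs.1, ht.1]) ht'.1 hs'.2 (by
      intro u hu
      rcases le_total 0 u with h0 | h0
      · exact hsub (hsI u ⟨h0, hu.2⟩)
      · have := htI (-u) ⟨by linarith, by linarith [hu.1]⟩
        rw [neg_neg] at this
        exact hsub this)
  have hts : -t ≤ s := by linarith [hs.1, ht.1]
  have hv := isVelocity_lift hr hpos (t₀ := 0) hz heq hδ' ht' htx
  have hw := isVelocity_lift hr hpos (t₀ := 0) hz heq hδ' hs' hsx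
  rw [zero_add] at hv hw
  have hleaf : toNullGeodesic (nullVector hr hpos (-t, (z (-t)).2.2, (z (-t)).2.1)) =
      toNullGeodesic (nullVector hr hpos (s, (z s).2.2, (z s).2.1)) :=
    Quot.sound ⟨lift r 0 z, J, hJ, hJc, hz.isGeodesicOn hρ hρpos hr hδ heq hJT hJx,
      -t, hIJ ⟨le_rfl, hts⟩, s, hIJ ⟨hts, le_rfl⟩, 1, one_pos, hv, hw.1,
      by rw [one_smul]; exact hw.2⟩
  have hcl : ∀ u ∈ Ioo (-(2 * K + 1)) (2 * K + 1), (z u).1 = 1 / 2 →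
      |r (1 / 2) * Real.cos (z u).2.1| < ε := by
    intro u hu hux
    have := hz.clairaut hρ hρpos hu
    rw [hux, hz0] at this
    simp only [Real.cos_zero, mul_one] at this
    rw [heq _ (hsub ⟨le_rfl, hb.1.le⟩), heq _ (hsub hbI)] at this
    rwa [this, abs_of_pos (hpos b ⟨by linarith [hb.1], hb.2⟩)]
  obtain ⟨φ₁, hφ₁, hφ₁c, hφ₁s⟩ := exists_mem_Icc_cos_sin_eq (z (-t)).2.2
  obtain ⟨θ₁, hθ₁, hθ₁c, hθ₁s⟩ := exists_mem_Icc_cos_sin_eq (z (-t)).2.1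
  obtain ⟨φ₂, hφ₂, hφ₂c, hφ₂s⟩ := exists_mem_Icc_cos_sin_eq (z s).2.2
  obtain ⟨θ₂, hθ₂, hθ₂c, hθ₂s⟩ := exists_mem_Icc_cos_sin_eq (z s).2.1
  refine ⟨(-t, φ₁, θ₁), ⟨⟨ht'.1.le, hφ₁.1, hθ₁.1⟩, ⟨ht'.2.le, hφ₁.2, hθ₁.2⟩⟩,
    (s, φ₂, θ₂), ⟨⟨hs'.1.le, hφ₂.1, hθ₂.1⟩, ⟨hs'.2.le, hφ₂.2, hθ₂.2⟩⟩, ?_, ?_, ?_, ?_, ?_⟩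
  · rw [nullVector_congr hr hpos hφ₁c hφ₁s hθ₁c hθ₁s,
      nullVector_congr hr hpos hφ₂c hφ₂s hθ₂c hθ₂s]
    exact hleaf
  · rw [hθ₁c]; exact hcl _ ht' htx
  · rw [hθ₂c]; exact hcl _ hs' hsx
  · rw [hθ₁s]; linarith
  · rw [hθ₂s]; exact hsin.le

end nullVector

/-- There is a sequence of null geodesics which converges to two different null geodesics over
meridians. -/
theorem exists_tendsto_two_limits {r : ℝ → ℝ} (hr : ContDiff ℝ ∞ r)
    (hpos : ∀ x ∈ Ioo (0 : ℝ) 1, 0 < r x) (h1 : r 1 = 0) :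
    ∃ (κ : ℕ → NullGeodesicSpace r) (κ₁ κ₂ : NullGeodesicSpace r),
      Tendsto κ atTop (𝓝 κ₁) ∧ Tendsto κ atTop (𝓝 κ₂) ∧ κ₁ ≠ κ₂ ∧
      IsOverMeridian κ₁ ∧ IsOverMeridian κ₂ := by
  obtain ⟨K, hK0, hK⟩ := exists_one_le_mul_invSpeed hr
  choose p hp q hq hpq hpc hqc hps hqs using fun n : ℕ =>
    exists_bounce hr hpos h1 hK0 hK (Nat.one_div_pos_of_nat (α := ℝ) (n := n))
  obtain ⟨⟨p₀, q₀⟩, -, ψ, hψ, hlim⟩ := (isCompact_Icc.prod isCompact_Icc).tendsto_subseq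
    (x := fun n => (p n, q n)) fun n => ⟨hp n, hq n⟩
  have hlp : Tendsto (p ∘ ψ) atTop (𝓝 p₀) := (continuous_fst.tendsto _).comp hlim
  have hlq : Tendsto (q ∘ ψ) atTop (𝓝 q₀) := (continuous_snd.tendsto _).comp hlim
  have hr2 : r (1 / 2) ≠ 0 := (hpos _ (by norm_num)).ne'
  have hε : Tendsto (fun n => 1 / ((ψ n : ℝ) + 1)) atTop (𝓝 0) :=
    tendsto_one_div_add_atTop_nhds_zero_nat.comp hψ.tendsto_atTop
  have hcos : Continuous fun x : ℝ × ℝ × ℝ => |r (1 / 2) * Real.cos x.2.2| := by fun_prop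
  have hsin : Continuous fun x : ℝ × ℝ × ℝ => Real.sin x.2.2 := by fun_prop
  have hp0 : Real.cos p₀.2.2 = 0 := by
    have := le_of_tendsto_of_tendsto' ((hcos.tendsto p₀).comp hlp) hε fun n => (hpc (ψ n)).le
    exact (mul_eq_zero.1 (abs_nonpos_iff.1 this)).resolve_left hr2
  have hq0 : Real.cos q₀.2.2 = 0 := by
    have := le_of_tendsto_of_tendsto' ((hcos.tendsto q₀).comp hlq) hε fun n => (hqc (ψ n)).le
    exact (mul_eq_zero.1 (abs_nonpos_iff.1 this)).resolve_left hr2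
  have hp1 : Real.sin p₀.2.2 ≤ 0 :=
    le_of_tendsto' ((hsin.tendsto p₀).comp hlp) fun n => hps (ψ n)
  have hq1 : 0 ≤ Real.sin q₀.2.2 :=
    ge_of_tendsto' ((hsin.tendsto q₀).comp hlq) fun n => hqs (ψ n)
  -- Only `≤` survives the limit, but `cos = 0` excludes `sin = 0`.
  have hp2 : Real.sin p₀.2.2 < 0 := by
    refine lt_of_le_of_ne hp1 fun h => ?_
    have := Real.sin_sq_add_cos_sq p₀.2.2
    rw [h, hp0] at this
    norm_num at this
  have hcont := continuous_toNullGeodesic.comp (continuous_nullVector hr hpos)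
  refine ⟨fun n => toNullGeodesic (nullVector hr hpos (p (ψ n))),
    toNullGeodesic (nullVector hr hpos p₀), toNullGeodesic (nullVector hr hpos q₀),
    (hcont.tendsto p₀).comp hlp, ?_, ?_, isOverMeridian_nullVector hr hpos hp0,
    isOverMeridian_nullVector hr hpos hq0⟩
  · simp only [hpq]
    exact (hcont.tendsto q₀).comp hlq
  · intro h
    have := isOutgoing_iff_of_toNullGeodesic_eq hr hpos h
    rw [isOutgoing_nullVector_iff hr hpos hp0,
      isOutgoing_nullVector_iff hr hpos hq0] at this
    linarith [this.1 hp2]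

end NullGeod

end

theorem proposition4p3 (r : ℝ → ℝ) (hr : ContDiff ℝ ∞ r)
    (hpos : ∀ x ∈ Ioo (0 : ℝ) 1, 0 < r x) (h0 : r 0 = 0) (h1 : r 1 = 0)
    (hd0 : |deriv r 0| < 1 / (2 * Real.pi)) (hd1 : |deriv r 1| < 1 / (2 * Real.pi)) :
    ¬ T2Space (NullGeod.NullGeodesicSpace r) ∧
    ∃ (κ : ℕ → NullGeod.NullGeodesicSpace r) (κ₁ κ₂ : NullGeod.NullGeodesicSpace r),
      Tendsto κ atTop (𝓝 κ₁) ∧ Tendsto κ atTop (𝓝 κ₂) ∧ κ₁ ≠ κ₂ ∧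
      NullGeod.IsOverMeridian κ₁ ∧ NullGeod.IsOverMeridian κ₂ := by
  have h := NullGeod.exists_tendsto_two_limits hr hpos h1
  refine ⟨fun hT2 => ?_, h⟩
  obtain ⟨κ, κ₁, κ₂, hκ₁, hκ₂, hne, -⟩ := h
  exact hne (tendsto_nhds_unique hκ₁ hκ₂)
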